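/- Let $X$ be a finite alphabet with $|X|\ge 2$ and let $G$ be a self-similar group over $X$, that is, a group acting faithfully by length-preserving permutations on the set $X^*$ of words over $X$ such that for all $g\in G$, $x\in X$ there is an element $g|_x\in G$ (the section of $g$ at $x$) with $g(xw)=g(x)\,g|_x(w)$ for all $w\in X^*$; put $g|_{\varepsilon}=g$ and $g|_{xv}=(g|_x)|_v$. A finite automaton in $G$ is a finite subset of $G$ closed under taking sections. Suppose that $G$ is contracting: there is a finite automaton $N\subseteq G$ such that for every $g\in G$ there is $n\ge 0$ with $g|_w\in N$ for all words $w$ of length $n$; the smallest such $N$ is the nucleus of $G$. Let $S$ be the associated inverse semigroup, i.e. the inverse hull of the left cancellative monoid $M=X^*G$ with product $ug\cdot vh=u\,g(v)\,g|_v\,h$ ($u,v\in X^*$, $g,h\in G$), consisting of the empty map and the partial bijections $ugv^*\colon vm\mapsto ugm$ of $M$. The groupoid associated to $G$ is the tight groupoid $\mathcal G_T(S)$, i.e. the groupoid of germs of the action of $S$ on the space of tight filters of its idempotent semilattice. Let $A\subseteq G$ be a finite automaton containing the nucleus of $G$. Define equivalence relations $\equiv_w$ on $A$ ($w\in X^*$)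 recursively: $\equiv_\varepsilon$ is equality, and for $x\in X$, $g\equiv_{xw}h$ if and only if $g(x)=h(x)$ and $g|_x\equiv_w h|_x$. Let $\Sigma_A$ be the finite digraph with vertex set $V=\{\equiv_w : w\in X^*\}$ and, for each $x\in X$, an edge labelled $x$ from each vertex $\equiv$ to the vertex $x\cdot{\equiv}$, where $g\mathrel{(x\cdot{\equiv})}h$ if and only if $g(x)=h(x)$ and $g|_x\equiv h|_x$. For $u\in X^*$ let $V_u=\{\equiv_{uw} : w\in X^*\}$. Let $V_{\min}$ be the set of vertices of $\Sigma_A$ lying in minimal strongly connected components (those that no edge leaves), and let $V_{\mathrm{ess}}$ be the set of essential vertices, i.e. those reachable from a directed cycle. Then $\mathcal G_T(S)$ is Hausdorff if and only if there exists $n\ge 0$ such that $|V_w|=1$ for all $w\in X^*$ of length $n$. In particular, if $\mathcal G_T(S)$ is Hausdorff, then $V_{\min}=V_{\mathrm{ess}}$. -/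

import Mathlib

/-! ### Inverse semigroups with zero -/

/-- An inverse semigroup with zero: every `s` has a unique element `star s` with
`s * star s * s = s` and `star s * s * star s = star s`. -/
class InverseSemigroupWithZero (S : Type*) extends SemigroupWithZero S, Star S where
  mul_star_mul : ∀ s : S, s * star s * s = s
  star_self_star : ∀ s : S, star s * s * star s = star s
  star_unique : ∀ s t : S, s * t * s = s → t * s * t = t → t = star s

namespace InverseSemigroupWithZero

variable {S : Type*} [InverseSemigroupWithZero S]

theorem star_idem {e : S} (he : IsIdempotentElem e) : star e = e := by
  have h : e * e = e := he
  exact (star_unique e e (by rw [h, h]) (by rw [h, h])).symm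

theorem star_star_self (s : S) : star (star s) = s :=
  (star_unique (star s) s (star_self_star s) (mul_star_mul s)).symm

theorem idem_mul {e f : S} (he : IsIdempotentElem e) (hf : IsIdempotentElem f) :
    IsIdempotentElem (e * f) := by
  have h1 : e * e = e := he
  have h2 : f * f = f := hf
  set x := star (e * f) with hx
  have a : e * f * x * (e * f) = e * f := mul_star_mul (e * f)
  have b : x * (e * f) * x = x := star_self_star (e * f)
  have key : f * x * e = x := by
    apply star_unique
    · calc e * f * (f * x * e) * (e * f) = e * (f * f) * x * (e * e) * f := by
            simp only [mul_assoc]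
        _ = e * f * x * (e * f) := by rw [h1, h2]; simp only [mul_assoc]
        _ = e * f := a
    · calc f * x * e * (e * f) * (f * x * e) = f * (x * ((e * e) * (f * f)) * x) * e := by
            simp only [mul_assoc]
        _ = f * x * e := by rw [h1, h2, b]
  have hxi : x * x = x := by
    calc x * x = (f * x * e) * (f * x * e) := by rw [key]
      _ = f * (x * (e * f) * x) * e := by simp only [mul_assoc]
      _ = x := by rw [b, key]
  have h3 : star x = x := star_idem hxi
  have h4 : star x = e * f := star_star_self (e * f)
  rw [← h4, h3]; exact hxi

theorem idem_comm {e f : S} (he : IsIdempotentElem e) (hf : IsIdempotentElem f) :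
    e * f = f * e := by
  have h1 : e * e = e := he
  have h2 : f * f = f := hf
  have hef : e * f * (e * f) = e * f := idem_mul he hf
  have hfe : f * e * (f * e) = f * e := idem_mul hf he
  have h3 : f * e = star (e * f) := by
    apply star_unique
    · calc e * f * (f * e) * (e * f) = e * (f * f) * (e * e) * f := by simp only [mul_assoc]
        _ = e * f := by rw [h1, h2, mul_assoc, hef]
    · calc f * e * (e * f) * (f * e) = f * (e * e) * (f * f) * e := by simp only [mul_assoc]
        _ = f * e := by rw [h1, h2, mul_assoc, hfe]
  rw [h3, star_idem (idem_mul he hf)]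

theorem idem_star_mul (s : S) : IsIdempotentElem (star s * s) := by
  change star s * s * (star s * s) = _
  rw [← mul_assoc, star_self_star]

theorem idem_mul_star (s : S) : IsIdempotentElem (s * star s) := by
  change s * star s * (s * star s) = _
  rw [← mul_assoc, mul_star_mul]

/-- `e s = s (star s e s)` for idempotents `e`. -/
theorem idem_mul_eq {e : S} (he : IsIdempotentElem e) (s : S) :
    s * (star s * e * s) = e * s := by
  calc s * (star s * e * s) = (s * star s) * e * s := by simp only [mul_assoc]
    _ = e * (s * star s) * s := by rw [idem_comm (idem_mul_star s) he]
    _ = e * s := by rw [mul_assoc, mul_star_mul]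

theorem star_mul_idem {e : S} (he : IsIdempotentElem e) (s : S) :
    star s * e * (s * star s) = star s * e := by
  rw [mul_assoc, idem_comm he (idem_mul_star s), ← mul_assoc, ← mul_assoc, star_self_star]

theorem conj_mul_conj {e : S} (he : IsIdempotentElem e) (f s : S) :
    (star s * e * s) * (star s * f * s) = star s * (e * f) * s := by
  calc (star s * e * s) * (star s * f * s) = star s * e * (s * star s) * f * s := by
        simp only [mul_assoc]
    _ = star s * (e * f) * s := by rw [star_mul_idem he]; simp only [mul_assoc]

theorem idem_conj {e : S} (he : IsIdempotentElem e) (s : S) :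
    IsIdempotentElem (star s * e * s) := by
  have h : e * e = e := he
  change _ * _ = _
  rw [conj_mul_conj he, h]

theorem star_mul_rev (s t : S) : star (s * t) = star t * star s := by
  have h := idem_comm (idem_star_mul s) (idem_mul_star t)
  refine (star_unique _ _ ?_ ?_).symm
  · calc s * t * (star t * star s) * (s * t) = s * ((t * star t) * (star s * s)) * t := by
          simp only [mul_assoc]
      _ = (s * star s * s) * (t * star t * t) := by rw [← h]; simp only [mul_assoc]
      _ = s * t := by rw [mul_star_mul, mul_star_mul]
  · calc star t * star s * (s * t) * (star t * star s)
        = star t * ((star s * s) * (t * star t)) * star s := by simp only [mul_assoc]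
      _ = (star t * t * star t) * (star s * s * star s) := by rw [h]; simp only [mul_assoc]
      _ = star t * star s := by rw [star_self_star, star_self_star]

end InverseSemigroupWithZero

/-! ### The tight groupoid of an inverse semigroup with zero -/

section TightGroupoid

open InverseSemigroupWithZero

/-- The finite set `C` of idempotents covers the idempotent `e`: every member of `C` lies below
`e`, and every nonzero idempotent below `e` meets some member of `C`.
(Recall `f ≤ e` means `f * e = f`.) -/
def Covers {S : Type*} [InverseSemigroupWithZero S] (C : Finset S) (e : S) : Prop :=
  (∀ c ∈ C, IsIdempotentElem c ∧ c * e = c) ∧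
    ∀ f : S, IsIdempotentElem f → f ≠ 0 → f * e = f → ∃ c ∈ C, f * c ≠ 0

/-- A tight filter: a proper filter of the semilattice of idempotents which, with each element `e`,
contains a member of every finite cover of `e`. -/
@[ext]
structure TightFilter (S : Type*) [InverseSemigroupWithZero S] where
  carrier : Set S
  idem : ∀ e ∈ carrier, IsIdempotentElem e
  nonempty : carrier.Nonempty
  zero_notMem : (0 : S) ∉ carrier
  mul_mem : ∀ e ∈ carrier, ∀ f ∈ carrier, e * f ∈ carrier
  mem_of_le : ∀ e ∈ carrier, ∀ f, IsIdempotentElem f → e * f = e → f ∈ carrier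
  tight : ∀ e ∈ carrier, ∀ C : Finset S, Covers C e → ∃ c ∈ C, c ∈ carrier

namespace TightFilter

variable {S : Type*} [InverseSemigroupWithZero S]

instance : Membership S (TightFilter S) := ⟨fun F e => e ∈ F.carrier⟩

/-- The topology of pointwise convergence of characters: it is generated by the sets
`{F | e ∈ F}` and their complements. -/
instance : TopologicalSpace (TightFilter S) :=
  TopologicalSpace.generateFrom
    {U | ∃ e : S, IsIdempotentElem e ∧ (U = {F | e ∈ F} ∨ U = {F | e ∉ F})}

/-- The partial action of `S` on tight filters: `s` takes a filter `F` containing `star s * s`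
to the filter of all idempotents `f` with `star s * f * s ∈ F`. -/
def act (s : S) (F : TightFilter S) (h : star s * s ∈ F) : TightFilter S where
  carrier := {f | IsIdempotentElem f ∧ star s * f * s ∈ F}
  idem := fun _ hf => hf.1
  nonempty := ⟨s * star s, idem_mul_star s, by
    have : star s * (s * star s) * s = star s * s := by
      rw [← mul_assoc (star s), star_self_star]
    rw [this]; exact h⟩
  zero_notMem := by
    rintro ⟨-, h0⟩
    rw [mul_zero, zero_mul] at h0
    exact F.zero_notMem h0
  mul_mem := by
    rintro e ⟨he, hes⟩ f ⟨hf, hfs⟩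
    refine ⟨idem_mul he hf, ?_⟩
    rw [← conj_mul_conj he]
    exact F.mul_mem _ hes _ hfs
  mem_of_le := by
    rintro e ⟨he, hes⟩ f hf hef
    refine ⟨hf, F.mem_of_le _ hes _ (idem_conj hf s) ?_⟩
    rw [conj_mul_conj he, hef]
  tight := by
    classical
    rintro e ⟨he, hes⟩ C ⟨hC1, hC2⟩
    obtain ⟨c', hc', hc'F⟩ := F.tight _ hes (C.image fun c => star s * c * s) (by
      refine ⟨?_, ?_⟩
      · intro c' hc'
        obtain ⟨c, hc, rfl⟩ := Finset.mem_image.1 hc'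
        refine ⟨idem_conj (hC1 c hc).1 s, ?_⟩
        rw [conj_mul_conj (hC1 c hc).1, (hC1 c hc).2]
      · intro g hg hg0 hge
        have hgs : g * (star s * s) = g := by
          calc g * (star s * s) = g * (star s * e * s) * (star s * s) := by rw [hge]
            _ = g * (star s * e * (s * star s) * s) := by simp only [mul_assoc]
            _ = g := by rw [star_mul_idem he, hge]
        have hsg : (star s * s) * g = g := by rw [idem_comm (idem_star_mul s) hg, hgs]
        have hgi : IsIdempotentElem (s * g * star s) := by
          have := idem_conj hg (star s)
          rwa [star_star_self] at this
        obtain ⟨c, hc, hne⟩ := hC2 (s * g * star s) hgi (by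
          intro h0
          apply hg0
          calc g = (star s * s) * g * (star s * s) := by rw [hsg, hgs]
            _ = star s * (s * g * star s) * s := by simp only [mul_assoc]
            _ = 0 := by rw [h0, mul_zero, zero_mul]) (by
          calc s * g * star s * e = s * g * (star s * e) := by simp only [mul_assoc]
            _ = s * (g * (star s * e * s)) * star s := by
                conv_lhs => rw [← star_mul_idem he]
                simp only [mul_assoc]
            _ = s * g * star s := by rw [hge])
        refine ⟨_, Finset.mem_image_of_mem _ hc, fun h0 => hne ?_⟩
        calc s * g * star s * c = s * g * (star s * c) := by simp only [mul_assoc]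
          _ = s * (g * (star s * c * s)) * star s := by
              conv_lhs => rw [← star_mul_idem (hC1 c hc).1]
              simp only [mul_assoc]
          _ = 0 := by rw [h0, mul_zero, zero_mul])
    obtain ⟨c, hc, rfl⟩ := Finset.mem_image.1 hc'
    exact ⟨c, hc, (hC1 c hc).1, hc'F⟩

end TightFilter

/-- Pairs `(s, F)` with `F` in the domain of the action of `s`. -/
structure PreGerm (S : Type*) [InverseSemigroupWithZero S] where
  elt : S
  filter : TightFilter S
  dom : star elt * elt ∈ filter

/-- `(s, F)` and `(t, F')` have the same germ iff `F = F'` and `s e = t e` for some `e ∈ F`. -/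
instance PreGerm.setoid (S : Type*) [InverseSemigroupWithZero S] : Setoid (PreGerm S) where
  r p q := p.filter = q.filter ∧ ∃ e ∈ p.filter, p.elt * e = q.elt * e
  iseqv :=
    { refl := fun p => ⟨rfl, _, p.dom, rfl⟩
      symm := by
        rintro p q ⟨h, e, he, hpq⟩
        exact ⟨h.symm, e, h ▸ he, hpq.symm⟩
      trans := by
        rintro p q r ⟨h, e, he, hpq⟩ ⟨h', f, hf, hqr⟩
        have hf' : f ∈ p.filter := by rw [h]; exact hf
        refine ⟨h.trans h', e * f, p.filter.mul_mem _ he _ hf', ?_⟩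
        calc p.elt * (e * f) = p.elt * e * f := by rw [mul_assoc]
          _ = q.elt * (e * f) := by rw [hpq, mul_assoc]
          _ = q.elt * (f * e) := by
              rw [idem_comm (p.filter.idem _ he) (p.filter.idem _ hf')]
          _ = r.elt * (f * e) := by rw [← mul_assoc, hqr, mul_assoc]
          _ = r.elt * (e * f) := by
              rw [idem_comm (p.filter.idem _ he) (p.filter.idem _ hf')] }

/-- The tight groupoid of `S` (its space of arrows): all germs `[s, F]` of the action of `S` on
the space of tight filters. -/
def TightGroupoid (S : Type*) [InverseSemigroupWithZero S] : Type _ :=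
  Quotient (PreGerm.setoid S)

namespace TightGroupoid

variable {S : Type*} [InverseSemigroupWithZero S]

/-- The germ `[s, F]`. -/
def germ (s : S) (F : TightFilter S) (h : star s * s ∈ F) : TightGroupoid S :=
  Quotient.mk _ ⟨s, F, h⟩

/-- The topology of the tight groupoid, generated by the sets
`Θ(s, U) = {[s, F] | F ∈ U, star s * s ∈ F}` for `s ∈ S` and `U` an open set of tight filters. -/
instance : TopologicalSpace (TightGroupoid S) :=
  TopologicalSpace.generateFrom
    {Θ | ∃ (s : S) (U : Set (TightFilter S)), IsOpen U ∧
      Θ = {γ | ∃ (F : TightFilter S) (h : star s * s ∈ F), F ∈ U ∧ γ = germ s F h}}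

/-- The source of `[s, F]` is `F`. -/
def source : TightGroupoid S → TightFilter S :=
  Quotient.lift (fun p => p.filter) fun _ _ h => h.1

theorem act_mono {s t : S} {F : TightFilter S} (hs : star s * s ∈ F) (ht : star t * t ∈ F)
    {e : S} (he : e ∈ F) (hst : s * e = t * e) {f : S} (hf : f ∈ F.act s hs) :
    f ∈ F.act t ht := by
  obtain ⟨hfi, hfF⟩ := hf
  refine ⟨hfi, F.mem_of_le _ (F.mul_mem _ (F.mul_mem _ he _ hfF) _ he) _ (idem_conj hfi t) ?_⟩
  have hei := F.idem e he
  have hee : e * e = e := hei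
  have key : e * (star s * f * s) * e = e * (star t * f * t) * e := by
    calc e * (star s * f * s) * e = star (s * e) * f * (s * e) := by
          rw [star_mul_rev, star_idem hei]; simp only [mul_assoc]
      _ = star (t * e) * f * (t * e) := by rw [hst]
      _ = e * (star t * f * t) * e := by
          rw [star_mul_rev, star_idem hei]; simp only [mul_assoc]
  rw [key]
  have hc := idem_conj hfi t
  have hcc : (star t * f * t) * (star t * f * t) = star t * f * t := hc
  generalize star t * f * t = c at hc hcc
  calc e * c * e * c = e * c * (e * c) := by rw [mul_assoc (e * c)]
    _ = e * c * (c * e) := by rw [idem_comm hei hc]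
    _ = e * (c * c) * e := by simp only [mul_assoc]
    _ = e * c * e := by rw [hcc]

/-- The range of `[s, F]` is the image of `F` under `s`. -/
def range : TightGroupoid S → TightFilter S :=
  Quotient.lift (fun p => p.filter.act p.elt p.dom) (by
    rintro ⟨s, F, hs⟩ ⟨t, F', ht⟩ ⟨h, e, he, hst⟩
    obtain rfl : F = F' := h
    exact TightFilter.ext (Set.ext fun f =>
      ⟨fun hf => act_mono hs ht he hst hf, fun hf => act_mono ht hs he hst.symm hf⟩))

theorem range_germ (s : S) (F : TightFilter S) (h : star s * s ∈ F) :
    range (germ s F h) = F.act s h := rfl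

theorem germ_eq {s t : S} {F : TightFilter S} {hs : star s * s ∈ F} {ht : star t * t ∈ F}
    (e : S) (he : e ∈ F) (h : s * e = t * e) : germ s F hs = germ t F ht :=
  Quotient.sound ⟨rfl, e, he, h⟩

theorem comp_dom {s t : S} {F : TightFilter S} {hs : star s * s ∈ F}
    (ht : star t * t ∈ F.act s hs) : star (t * s) * (t * s) ∈ F := by
  have h := ht.2
  rw [star_mul_rev]
  simpa only [mul_assoc] using h

theorem act_act {s t : S} {F : TightFilter S} {hs : star s * s ∈ F}
    (ht : star t * t ∈ F.act s hs) : (F.act s hs).act t ht = F.act (t * s) (comp_dom ht) := by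
  refine TightFilter.ext (Set.ext fun f => ?_)
  have h : star (t * s) * f * (t * s) = star s * (star t * f * t) * s := by
    rw [star_mul_rev]; simp only [mul_assoc]
  constructor
  · rintro ⟨hf, hf'⟩
    exact ⟨hf, by rw [h]; exact hf'.2⟩
  · rintro ⟨hf, hf'⟩
    exact ⟨hf, idem_conj hf t, by rw [← h]; exact hf'⟩

theorem inv_dom {s : S} {F : TightFilter S} (hs : star s * s ∈ F) :
    star (star s) * star s ∈ F.act s hs := by
  rw [star_star_self]
  refine ⟨idem_mul_star s, ?_⟩
  rwa [← mul_assoc (star s), star_self_star]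

theorem act_congr {s t : S} {F : TightFilter S} {hs : star s * s ∈ F} {ht : star t * t ∈ F}
    (h : germ s F hs = germ t F ht) : F.act s hs = F.act t ht := by
  rw [← range_germ, h, range_germ]

theorem germ_congr {s t : S} {F F' : TightFilter S} {hs : star s * s ∈ F} {ht : star t * t ∈ F'}
    (hF : F = F') (h : s = t) : germ s F hs = germ t F' ht := by
  subst hF; subst h; rfl

theorem exists_of_germ_eq {s t : S} {F : TightFilter S} {hs : star s * s ∈ F}
    {ht : star t * t ∈ F} (h : germ s F hs = germ t F ht) : ∃ e ∈ F, s * e = t * e :=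
  (Quotient.exact h).2

/-- The arrows from `F` to `F'`: the germs with source `F` and range `F'`. -/
def Arrow (F F' : TightFilter S) : Type _ :=
  {γ : TightGroupoid S // source γ = F ∧ range γ = F'}

/-- The germ `[s, F]` as an arrow from `F` to `F' = s F`. -/
def Arrow.mk (s : S) (F F' : TightFilter S) (hs : star s * s ∈ F) (h : F.act s hs = F') :
    Arrow F F' :=
  ⟨germ s F hs, rfl, h⟩

theorem Arrow.exists_rep {F F' : TightFilter S} (γ : Arrow F F') :
    ∃ (s : S) (hs : star s * s ∈ F) (h : F.act s hs = F'), γ = Arrow.mk s F F' hs h := by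
  obtain ⟨γ, h1, h2⟩ := γ
  induction γ using Quotient.inductionOn with
  | h p =>
    obtain ⟨s, F₀, hs⟩ := p
    obtain rfl : F₀ = F := h1
    exact ⟨s, hs, h2, rfl⟩

theorem comp_congr {s s' t t' : S} {F F' : TightFilter S} {hs : star s * s ∈ F}
    {hs' : star s' * s' ∈ F} {ht : star t * t ∈ F'} {ht' : star t' * t' ∈ F'}
    (hF : F.act s hs = F') (h1 : germ s F hs = germ s' F hs')
    (h2 : germ t F' ht = germ t' F' ht') {h : star (t * s) * (t * s) ∈ F}
    {h' : star (t' * s') * (t' * s') ∈ F} :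
    germ (t * s) F h = germ (t' * s') F h' := by
  subst hF
  obtain ⟨e, he, hse⟩ := exists_of_germ_eq h1
  obtain ⟨f, hf, htf⟩ := exists_of_germ_eq h2
  obtain ⟨hfi, hf⟩ := hf
  refine germ_eq (star s * f * s * e) (F.mul_mem _ hf _ he) ?_
  calc t * s * (star s * f * s * e) = t * (s * (star s * f * s)) * e := by
        simp only [mul_assoc]
    _ = (t * f) * (s * e) := by rw [idem_mul_eq hfi]; simp only [mul_assoc]
    _ = (t' * f) * (s' * e) := by rw [htf, hse]
    _ = t' * (f * (s' * e)) := by simp only [mul_assoc]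
    _ = t' * (f * (s * e)) := by rw [hse]
    _ = t' * (s * (star s * f * s)) * e := by rw [idem_mul_eq hfi]; simp only [mul_assoc]
    _ = t' * (s * (star s * f * s) * e) := by simp only [mul_assoc]
    _ = t' * (s * (e * (star s * f * s))) := by
        rw [idem_comm (F.idem e he) (idem_conj hfi s)]; simp only [mul_assoc]
    _ = t' * (s' * (e * (star s * f * s))) := by rw [← mul_assoc s, hse, mul_assoc]
    _ = t' * s' * (star s * f * s * e) := by
        rw [idem_comm (F.idem e he) (idem_conj hfi s)]; simp only [mul_assoc]

theorem inv_congr {s s' : S} {F F' : TightFilter S} {hs : star s * s ∈ F}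
    {hs' : star s' * s' ∈ F} (hF : F.act s hs = F') (h1 : germ s F hs = germ s' F hs')
    {h : star (star s) * star s ∈ F'} {h' : star (star s') * star s' ∈ F'} :
    germ (star s) F' h = germ (star s') F' h' := by
  subst hF
  obtain ⟨e, he, hse⟩ := exists_of_germ_eq h1
  have hei := F.idem e he
  have hc := idem_conj hei (star s)
  rw [star_star_self] at hc
  have key : ∀ r : S, star r * (r * e * star r) = e * star r := by
    intro r
    have := idem_mul_eq hei (star r)
    rwa [star_star_self] at this
  have h2 : e * star s = e * star s' := by
    have := congrArg star hse
    rwa [star_mul_rev, star_mul_rev, star_idem hei] at this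
  have h3 : s * e * star s = s' * e * star s' := by
    rw [mul_assoc, h2, ← mul_assoc, hse]
  refine germ_eq (s * e * star s) ⟨hc, ?_⟩ ?_
  · have : star s * (s * e * star s) * s = (star s * s) * e * (star s * s) := by
      simp only [mul_assoc]
    rw [this]
    exact F.mul_mem _ (F.mul_mem _ hs _ he) _ hs
  · rw [key, h3, key, h2]

theorem unit_dom {e : S} {F : TightFilter S} (he : e ∈ F) : star e * e ∈ F := by
  rw [star_idem (F.idem e he), show e * e = e from F.idem e he]; exact he

theorem act_unit {e : S} {F : TightFilter S} (he : e ∈ F) : F.act e (unit_dom he) = F := by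
  have hei := F.idem e he
  refine TightFilter.ext (Set.ext fun f => ⟨?_, fun hf => ?_⟩)
  · rintro ⟨hfi, hf⟩
    refine F.mem_of_le _ hf f hfi ?_
    have h2 : f * f = f := hfi
    rw [star_idem hei]
    calc e * f * e * f = e * f * (e * f) := by rw [mul_assoc (e * f)]
      _ = e * f * (f * e) := by rw [idem_comm hei hfi]
      _ = e * (f * f) * e := by simp only [mul_assoc]
      _ = e * f * e := by rw [h2]
  · refine ⟨F.idem f hf, ?_⟩
    rw [star_idem hei]
    exact F.mul_mem _ (F.mul_mem _ he _ hf) _ he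

theorem comp_dom' {s t : S} {F F' : TightFilter S} {hs : star s * s ∈ F}
    (hF : F.act s hs = F') (ht : star t * t ∈ F') : star (t * s) * (t * s) ∈ F := by
  subst hF; exact comp_dom ht

theorem comp_act {s t : S} {F F' F'' : TightFilter S} {hs : star s * s ∈ F}
    (hF : F.act s hs = F') {ht : star t * t ∈ F'} (hF' : F'.act t ht = F'') :
    F.act (t * s) (comp_dom' hF ht) = F'' := by
  subst hF; rw [← hF', act_act]

theorem inv_dom' {s : S} {F F' : TightFilter S} {hs : star s * s ∈ F} (hF : F.act s hs = F') :
    star (star s) * star s ∈ F' := by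
  subst hF; exact inv_dom hs

theorem inv_act {s : S} {F F' : TightFilter S} {hs : star s * s ∈ F} (hF : F.act s hs = F') :
    F'.act (star s) (inv_dom' hF) = F := by
  subst hF; rw [act_act, act_unit hs]

/-- The unit at `F` is the germ `[e, F]` for any `e ∈ F`. -/
noncomputable def Arrow.id (F : TightFilter S) : Arrow F F :=
  Arrow.mk F.nonempty.some F F (unit_dom F.nonempty.some_mem) (act_unit F.nonempty.some_mem)

/-- The composite of `[s, F]` followed by `[t, s F]` is `[t * s, F]`. -/
noncomputable def Arrow.comp {F F' F'' : TightFilter S} (γ : Arrow F F') (δ : Arrow F' F'') :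
    Arrow F F'' :=
  Arrow.mk (δ.exists_rep.choose * γ.exists_rep.choose) F F''
    (comp_dom' γ.exists_rep.choose_spec.choose_spec.choose δ.exists_rep.choose_spec.choose)
    (comp_act γ.exists_rep.choose_spec.choose_spec.choose
      δ.exists_rep.choose_spec.choose_spec.choose)

/-- The inverse of `[s, F]` is `[star s, s F]`. -/
noncomputable def Arrow.inv {F F' : TightFilter S} (γ : Arrow F F') : Arrow F' F :=
  Arrow.mk (star γ.exists_rep.choose) F' F (inv_dom' γ.exists_rep.choose_spec.choose_spec.choose)
    (inv_act γ.exists_rep.choose_spec.choose_spec.choose)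

theorem Arrow.id_eq (F : TightFilter S) (e : S) (he : e ∈ F) :
    Arrow.id F = Arrow.mk e F F (unit_dom he) (act_unit he) := by
  refine Subtype.ext (germ_eq (F.nonempty.some * e) (F.mul_mem _ F.nonempty.some_mem _ he) ?_)
  have h1 := F.idem _ F.nonempty.some_mem
  have h2 := F.idem _ he
  have h1' : _ * _ = _ := h1
  have h2' : e * e = e := h2
  rw [← mul_assoc, h1', idem_comm h1 h2, ← mul_assoc, h2']

theorem Arrow.comp_mk {F F' F'' : TightFilter S} (s t : S) (hs : star s * s ∈ F)
    (hF : F.act s hs = F') (ht : star t * t ∈ F') (hF' : F'.act t ht = F'') :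
    (Arrow.mk s F F' hs hF).comp (Arrow.mk t F' F'' ht hF') =
      Arrow.mk (t * s) F F'' (comp_dom' hF ht) (comp_act hF hF') := by
  have h1 := (Arrow.mk s F F' hs hF).exists_rep.choose_spec.choose_spec.choose_spec
  have h2 := (Arrow.mk t F' F'' ht hF').exists_rep.choose_spec.choose_spec.choose_spec
  exact Subtype.ext (comp_congr hF (congrArg Subtype.val h1) (congrArg Subtype.val h2)).symm

theorem Arrow.inv_mk {F F' : TightFilter S} (s : S) (hs : star s * s ∈ F)
    (hF : F.act s hs = F') :
    (Arrow.mk s F F' hs hF).inv = Arrow.mk (star s) F' F (inv_dom' hF) (inv_act hF) := by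
  have h1 := (Arrow.mk s F F' hs hF).exists_rep.choose_spec.choose_spec.choose_spec
  exact Subtype.ext (inv_congr hF (congrArg Subtype.val h1)).symm

/-- The tight groupoid as a groupoid whose objects are the tight filters and whose arrows are the
germs. -/
noncomputable instance : CategoryTheory.Groupoid (TightFilter S) where
  Hom F F' := Arrow F F'
  id F := Arrow.id F
  comp γ δ := γ.comp δ
  inv γ := γ.inv
  id_comp := by
    rintro F F' γ
    obtain ⟨s, hs, h, rfl⟩ := γ.exists_rep
    rw [Arrow.id_eq F _ hs, Arrow.comp_mk]
    exact Subtype.ext (germ_congr rfl (by rw [← mul_assoc, mul_star_mul]))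
  comp_id := by
    rintro F F' γ
    obtain ⟨s, hs, rfl, rfl⟩ := γ.exists_rep
    rw [Arrow.id_eq _ _ (inv_dom hs), Arrow.comp_mk]
    exact Subtype.ext (germ_congr rfl (by rw [star_star_self, mul_star_mul]))
  assoc := by
    rintro F F' F'' F''' γ δ ε
    obtain ⟨s, hs, h, rfl⟩ := γ.exists_rep
    obtain ⟨t, ht, h', rfl⟩ := δ.exists_rep
    obtain ⟨r, hr, h'', rfl⟩ := ε.exists_rep
    simp only [Arrow.comp_mk]
    exact Subtype.ext (germ_congr rfl (mul_assoc _ _ _).symm)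
  inv_comp := by
    rintro F F' γ
    obtain ⟨s, hs, rfl, rfl⟩ := γ.exists_rep
    rw [Arrow.id_eq _ _ (inv_dom hs), Arrow.inv_mk, Arrow.comp_mk]
    exact Subtype.ext (germ_congr rfl (by rw [star_star_self]))
  comp_inv := by
    rintro F F' γ
    obtain ⟨s, hs, h, rfl⟩ := γ.exists_rep
    rw [Arrow.id_eq _ _ hs, Arrow.inv_mk, Arrow.comp_mk]

end TightGroupoid

end TightGroupoid

/-! ### Inverse hulls -/

section InverseHull

variable (M : Type*) [Monoid M] [IsLeftCancelMul M]

open Classical in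
/-- Left multiplication by `m` as a partial bijection of `M`. -/
noncomputable def leftMulPEquiv {M : Type*} [Monoid M] [IsLeftCancelMul M] (m : M) : M ≃. M where
  toFun k := some (m * k)
  invFun n := if h : ∃ k, m * k = n then some h.choose else none
  inv k n := by
    constructor
    · intro h
      split_ifs at h with hk
      have h1 := hk.choose_spec
      rw [Option.some.inj h] at h1
      rw [h1]
    · intro h
      have h1 : ∃ k, m * k = n := ⟨k, Option.some.inj h⟩
      rw [dif_pos h1]
      exact congrArg some (mul_left_cancel (h1.choose_spec.trans (Option.some.inj h).symm))

/-- The partial bijections of `M` generated by the left multiplications under composition and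
inversion, together with the empty map `⊥` (which is a composite `(m ⬝)⁻¹ ∘ (m' ⬝)` anyway as soon
as two elements `m`, `m'` have no common right multiple). -/
inductive InInverseHull : (M ≃. M) → Prop
  | leftMul (m : M) : InInverseHull (leftMulPEquiv m)
  | bot : InInverseHull ⊥
  | symm {f : M ≃. M} : InInverseHull f → InInverseHull f.symm
  | trans {f g : M ≃. M} : InInverseHull f → InInverseHull g → InInverseHull (f.trans g)

/-- The inverse hull (with zero) of a left cancellative monoid. -/
def InverseHull : Type _ := {f : M ≃. M // InInverseHull M f}

/-- The product of partial bijections is composition (the right factor is applied first), `star`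
is inversion and `0` is the empty map. -/
instance : InverseSemigroupWithZero (InverseHull M) where
  mul s t := ⟨t.1.trans s.1, t.2.trans s.2⟩
  zero := ⟨⊥, .bot⟩
  star s := ⟨s.1.symm, s.2.symm⟩
  mul_assoc s t r := Subtype.ext (PEquiv.trans_assoc r.1 t.1 s.1).symm
  zero_mul s := Subtype.ext (PEquiv.trans_bot s.1)
  mul_zero s := Subtype.ext (PEquiv.bot_trans s.1)
  mul_star_mul s := by
    obtain ⟨s, hs⟩ := s
    refine Subtype.ext ?_
    change s.trans (s.symm.trans s) = s
    refine PEquiv.ext fun a => Option.ext fun b => ?_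
    simp only [PEquiv.trans_eq_some, PEquiv.eq_some_iff]
    constructor
    · rintro ⟨c, hc, d, hd, hb⟩
      rwa [s.inj hc hd]
    · intro h
      exact ⟨b, h, a, h, h⟩
  star_self_star s := by
    obtain ⟨s, hs⟩ := s
    refine Subtype.ext ?_
    change s.symm.trans (s.trans s.symm) = s.symm
    refine PEquiv.ext fun a => Option.ext fun b => ?_
    simp only [PEquiv.trans_eq_some, PEquiv.eq_some_iff]
    constructor
    · rintro ⟨c, hc, d, hd, hb⟩
      obtain rfl : a = d := Option.some.inj (hc.symm.trans hd)
      exact hb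
    · intro h
      exact ⟨b, h, a, h, h⟩
  star_unique s t h1 h2 := by
    obtain ⟨s, hs⟩ := s
    obtain ⟨t, ht⟩ := t
    replace h1 : s.trans (t.trans s) = s := congrArg Subtype.val h1
    replace h2 : t.trans (s.trans t) = t := congrArg Subtype.val h2
    refine Subtype.ext ?_
    change t = s.symm
    refine PEquiv.ext fun a => Option.ext fun b => ?_
    rw [PEquiv.eq_some_iff]
    constructor
    · intro h
      have h' := h
      rw [← h2] at h'
      simp only [PEquiv.trans_eq_some] at h'
      obtain ⟨c, hc, d, hd, hb⟩ := h'
      obtain rfl : b = c := Option.some.inj (h.symm.trans hc)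
      obtain rfl : a = d := t.inj h hb
      exact hd
    · intro h
      have h' := h
      rw [← h1] at h'
      simp only [PEquiv.trans_eq_some] at h'
      obtain ⟨c, hc, d, hd, hb⟩ := h'
      obtain rfl : a = c := Option.some.inj (h.symm.trans hc)
      obtain rfl : b = d := s.inj h hb
      exact hd

end InverseHull

/-! ### Self-similar groups -/

/-- A self-similar group `G` over the alphabet `X`: a faithful length-preserving action of `G` on
the words over `X` such that for all `g` and `x` there is `h` (the section of `g` at `x`) with
`g (x w) = g (x) h (w)` for all words `w`. -/
class SelfSimilarGroup (G X : Type*) [Group G] [MulAction G (List X)] : Prop where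
  faithful : ∀ g h : G, (∀ w : List X, g • w = h • w) → g = h
  length_smul : ∀ (g : G) (w : List X), (g • w).length = w.length
  exists_section : ∀ (g : G) (x : X), ∃ h : G, ∀ w : List X, g • (x :: w) = g • [x] ++ h • w

namespace SelfSimilarGroup

variable {G X : Type*} [Group G] [MulAction G (List X)] [SelfSimilarGroup G X]

/-- The section `g|_x` at a letter. -/
noncomputable def sectionLetter (g : G) (x : X) : G := (exists_section g x).choose

/-- The section `g|_w` at a word: `g|_{x v} = (g|_x)|_v`. -/
noncomputable def sec (g : G) : List X → G
  | [] => g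
  | x :: v => sec (sectionLetter g x) v

theorem smul_append (g : G) (u v : List X) : g • (u ++ v) = g • u ++ sec g u • v := by
  induction u generalizing g with
  | nil =>
    have : g • ([] : List X) = [] := List.eq_nil_of_length_eq_zero (length_smul g [])
    rw [List.nil_append, this, List.nil_append]; rfl
  | cons x u ih =>
    have h := (exists_section g x).choose_spec
    rw [List.cons_append, h, h u, List.append_assoc]
    exact congrArg _ (ih _)

theorem sec_unique {g h : G} {u : List X} (H : ∀ v, g • (u ++ v) = g • u ++ h • v) :
    h = sec g u :=
  faithful _ _ fun v => List.append_cancel_left ((H v).symm.trans (smul_append g u v))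

theorem smul_nil (g : G) : g • ([] : List X) = [] :=
  List.eq_nil_of_length_eq_zero (length_smul g [])

theorem sec_append (g : G) (u v : List X) : sec g (u ++ v) = sec (sec g u) v := by
  refine (sec_unique fun w => ?_).symm
  rw [List.append_assoc, smul_append, smul_append, smul_append, List.append_assoc]

theorem sec_mul (g h : G) (u : List X) : sec (g * h) u = sec g (h • u) * sec h u := by
  refine (sec_unique fun w => ?_).symm
  rw [mul_smul, mul_smul, mul_smul, smul_append, smul_append]

theorem sec_one (u : List X) : sec (1 : G) u = 1 :=
  (sec_unique fun w => by rw [one_smul, one_smul, one_smul]).symm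

end SelfSimilarGroup

section SelfSimilar

open SelfSimilarGroup

/-- The set `X* G` of pairs `u g` with `u` a word and `g ∈ G`. -/
@[ext]
structure WordMonoid (G X : Type*) where
  word : List X
  elt : G

/-- The product `u g ⬝ v h = u g(v) g|_v h`. -/
noncomputable instance (G X : Type*) [Group G] [MulAction G (List X)] [SelfSimilarGroup G X] :
    Monoid (WordMonoid G X) where
  mul a b := ⟨a.word ++ a.elt • b.word, sec a.elt b.word * b.elt⟩
  one := ⟨[], 1⟩
  mul_assoc a b c := by
    refine WordMonoid.ext ?_ ?_
    · change (a.word ++ a.elt • b.word) ++ (sec a.elt b.word * b.elt) • c.word =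
        a.word ++ a.elt • (b.word ++ b.elt • c.word)
      rw [smul_append, mul_smul, List.append_assoc]
    · change sec (sec a.elt b.word * b.elt) c.word * c.elt =
        sec a.elt (b.word ++ b.elt • c.word) * (sec b.elt c.word * c.elt)
      rw [sec_mul, sec_append, mul_assoc]
  one_mul a := by
    refine WordMonoid.ext ?_ ?_
    · change [] ++ (1 : G) • a.word = a.word
      rw [one_smul, List.nil_append]
    · change sec (1 : G) a.word * a.elt = a.elt
      rw [sec_one, one_mul]
  mul_one a := by
    refine WordMonoid.ext ?_ ?_
    · change a.word ++ a.elt • ([] : List X) = a.word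
      rw [smul_nil, List.append_nil]
    · change sec a.elt ([] : List X) * 1 = a.elt
      rw [mul_one]; rfl

instance (G X : Type*) [Group G] [MulAction G (List X)] [SelfSimilarGroup G X] :
    IsLeftCancelMul (WordMonoid G X) where
  mul_left_cancel a b c h := by
    have h1 : a.word ++ a.elt • b.word = a.word ++ a.elt • c.word := congrArg WordMonoid.word h
    have h2 : sec a.elt b.word * b.elt = sec a.elt c.word * c.elt := congrArg WordMonoid.elt h
    have h3 : b.word = c.word := MulAction.injective a.elt (List.append_cancel_left h1)
    rw [h3] at h2
    exact WordMonoid.ext h3 (mul_left_cancel h2)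

/-- The inverse semigroup associated to the self-similar group `G` over `X`. -/
abbrev SelfSimilarGroup.inverseSemigroup (G X : Type*) [Group G] [MulAction G (List X)]
    [SelfSimilarGroup G X] : Type _ :=
  InverseHull (WordMonoid G X)

/-! ### Automata, contracting groups and the nucleus -/

/-- A finite automaton in `G`: a finite subset closed under taking sections. -/
structure FiniteAutomaton (G X : Type*) [Group G] [MulAction G (List X)]
    [SelfSimilarGroup G X] where
  carrier : Set G
  finite : carrier.Finite
  sec_mem : ∀ g ∈ carrier, ∀ x : X, sectionLetter g x ∈ carrier

/-- The finite automaton `N` absorbs all deep sections: for every `g ∈ G` there is `n` with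
`g|_w ∈ N` for all words `w` of length `n`. -/
def FiniteAutomaton.Absorbing {G X : Type*} [Group G] [MulAction G (List X)]
    [SelfSimilarGroup G X] (N : FiniteAutomaton G X) : Prop :=
  ∀ g : G, ∃ n : ℕ, ∀ w : List X, w.length = n → sec g w ∈ N.carrier

/-- A self-similar group is contracting if some finite automaton absorbs all deep sections. -/
def IsContracting (G X : Type*) [Group G] [MulAction G (List X)] [SelfSimilarGroup G X] : Prop :=
  ∃ N : FiniteAutomaton G X, N.Absorbing

/-- The nucleus: the smallest absorbing finite automaton of a contracting group (the intersection
of all of them). -/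
def nucleus (G X : Type*) [Group G] [MulAction G (List X)] [SelfSimilarGroup G X] : Set G :=
  ⋂ N : {N : FiniteAutomaton G X // N.Absorbing}, N.1.carrier

theorem FiniteAutomaton.sec_mem' {G X : Type*} [Group G] [MulAction G (List X)]
    [SelfSimilarGroup G X] (N : FiniteAutomaton G X) {g : G} (hg : g ∈ N.carrier) (w : List X) :
    sec g w ∈ N.carrier := by
  induction w generalizing g with
  | nil => exact hg
  | cons x w ih => exact ih (N.sec_mem g hg x)

/-- The nucleus of a contracting group is indeed an absorbing finite automaton, and it is contained
in every other one. -/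
theorem nucleus_isLeast {G X : Type*} [Group G] [MulAction G (List X)] [SelfSimilarGroup G X]
    (hG : IsContracting G X) :
    IsLeast {C : Set G | ∃ N : FiniteAutomaton G X, N.Absorbing ∧ N.carrier = C}
      (nucleus G X) := by
  obtain ⟨N₀, hN₀⟩ := hG
  refine ⟨⟨⟨nucleus G X, N₀.finite.subset (Set.iInter_subset _ (⟨N₀, hN₀⟩ : {N // _})), ?_⟩,
    ?_, rfl⟩, ?_⟩
  · intro g hg x
    exact Set.mem_iInter.2 fun N => N.1.sec_mem g (Set.mem_iInter.1 hg N) x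
  · intro g
    have hex : ∀ h : G, ∃ n : ℕ, h ∈ N₀.carrier → h ∉ nucleus G X →
        ∀ w : List X, n ≤ w.length → sec g w ≠ h := by
      intro h
      by_cases hh : h ∈ nucleus G X
      · exact ⟨0, fun _ h' => (h' hh).elim⟩
      · obtain ⟨N, hN⟩ := not_forall.1 (fun H => hh (Set.mem_iInter.2 H))
        obtain ⟨n, hn⟩ := N.2 g
        refine ⟨n, fun _ _ w hw heq => hN ?_⟩
        rw [← heq, ← List.take_append_drop n w, sec_append]
        exact N.1.sec_mem' (hn _ (by rw [List.length_take, min_eq_left hw])) _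
    choose b hb using hex
    obtain ⟨m, hm⟩ := hN₀ g
    refine ⟨m + ∑ h ∈ N₀.finite.toFinset, b h, fun w hw => ?_⟩
    have h1 : sec g w ∈ N₀.carrier := by
      rw [← List.take_append_drop m w, sec_append]
      exact N₀.sec_mem' (hm _ (by rw [List.length_take, hw]; omega)) _
    by_contra h2
    refine hb _ h1 h2 w ?_ rfl
    have := Finset.single_le_sum (f := b) (fun _ _ => Nat.zero_le _)
      (N₀.finite.mem_toFinset.2 h1)
    omega
  · rintro C ⟨N, hN, rfl⟩
    exact Set.iInter_subset _ (⟨N, hN⟩ : {N // _})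

/-! ### Finite digraphs -/

/-- A vertex of a digraph (given by its edge relation) lies in a minimal strongly connected
component if it can be reached back from every vertex that is reachable from it. -/
def IsMinimalVertex {V : Type*} (edge : V → V → Prop) (v : V) : Prop :=
  ∀ v', Relation.ReflTransGen edge v v' → Relation.ReflTransGen edge v' v

/-- A vertex of a finite digraph is essential if it is reachable from a directed cycle. -/
def IsEssentialVertex {V : Type*} (edge : V → V → Prop) (v : V) : Prop :=
  ∃ c, Relation.TransGen edge c c ∧ Relation.ReflTransGen edge c v

/-! ### The simplicity graph of an automaton -/

namespace FiniteAutomaton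

variable {G X : Type*} [Group G] [MulAction G (List X)] [SelfSimilarGroup G X]
  (A : FiniteAutomaton G X)

/-- The section of a state at a letter, as a state. -/
noncomputable def next (g : A.carrier) (x : X) : A.carrier :=
  ⟨sectionLetter g.1 x, A.sec_mem g.1 g.2 x⟩

/-- The equivalence relation `x ⬝ ≡` on the states: `g` and `h` are related iff `g (x) = h (x)`
and `g|_x ≡ h|_x`. -/
def letterAct (x : X) (r : Setoid A.carrier) : Setoid A.carrier where
  r g h := g.1 • [x] = h.1 • [x] ∧ r (A.next g x) (A.next h x)
  iseqv :=
    { refl := fun _ => ⟨rfl, r.refl _⟩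
      symm := fun h => ⟨h.1.symm, r.symm h.2⟩
      trans := fun h h' => ⟨h.1.trans h'.1, r.trans h.2 h'.2⟩ }

/-- The equivalence relation `≡_w` on the states: `≡_∅` is equality, and `≡_{x w}` is
`x ⬝ ≡_w`. -/
def wordRel : List X → Setoid A.carrier
  | [] => ⊥
  | x :: w => A.letterAct x (wordRel w)

/-- The vertices of the simplicity graph `Σ_A`: the relations `≡_w`. -/
def Vertex : Type _ := {r : Setoid A.carrier // ∃ w : List X, r = A.wordRel w}

/-- The vertex `≡_w`. -/
def vertex (w : List X) : A.Vertex := ⟨A.wordRel w, w, rfl⟩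

/-- The simplicity graph `Σ_A`: its edges labelled `x` are `≡ ⟶ x ⬝ ≡`. -/
def LabelledEdge (x : X) (v v' : A.Vertex) : Prop := v'.1 = A.letterAct x v.1

/-- The edge relation of the simplicity graph, without labels. -/
def Edge (v v' : A.Vertex) : Prop := ∃ x : X, A.LabelledEdge x v v'

/-- `V_u`, the set of all vertices `≡_{u w}`. -/
def reachSet (u : List X) : Set A.Vertex := {v | ∃ w : List X, v = A.vertex (u ++ w)}

/-- `V_min`, the vertices in the minimal components of the simplicity graph. -/
def minimalVertices : Set A.Vertex := {v | IsMinimalVertex A.Edge v}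

/-- `V_ess`, the essential vertices of the simplicity graph. -/
def essentialVertices : Set A.Vertex := {v | IsEssentialVertex A.Edge v}

end FiniteAutomaton

end SelfSimilar

/-! Everything passes through one condition on the group: for each `g` there is `n` such that,
whenever `g` fixes an extension `w v` of a word `w` of length `n` and has trivial section there, it
already does so at `w` (`TrivialAt`).

This condition is equivalent to Hausdorffness (`t2Space_iff`). Nonzero idempotents of `S` are
cylinders `w w*`, so infinite words give tight filters, and the germs of `g` and `1` at `ξ` coincide
iff `g` is trivial at some prefix of `ξ`. Those `ξ` form an increasing union of open sets. If the
groupoid is Hausdorff, the union is closed, hence compact, hence attained at a single stage `n`.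
Conversely, below a deep enough cylinder any two elements of `S` are left multiplications by some
`a` and `c`. Their agreement is triviality of `c.elt⁻¹ * a.elt`, and the bound turns agreement near
a filter into agreement at it.

The condition is also equivalent to the statement about `V_w`. By `wordRel_iff`, `g ≡_w h` iff `h⁻¹
g` is trivial at `w`, and `V_w` is a singleton iff `≡_w` no longer changes when `w` is extended.
Finiteness of `A` makes the bounds for all `h⁻¹ g` uniform. Conversely, contraction moves any `g`
into the nucleus after `m` letters, where its section can be compared with `1` inside `A`, so `m +
n` works.

For the last claim, going round a cycle shows that an essential vertex is `≡_w` with `w` long, so it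
equals `≡_p` for a prefix `p` of length `n`. From any `≡_{u p}` one can prepend `p` and return to
`≡_{p u p} = ≡_p`. -/

namespace InverseHull

/-! ### Elements and idempotents of an inverse hull -/

variable {M : Type*} [Monoid M] [IsLeftCancelMul M]

/-- Left multiplication by `m` as an element of the inverse hull. -/
noncomputable def ofMul (m : M) : InverseHull M := ⟨leftMulPEquiv m, .leftMul m⟩

/-- The partial bijection `b k ↦ a k`. -/
noncomputable def frac (a b : M) : InverseHull M := ofMul a * star (ofMul b)

theorem mul_apply_eq_some {s t : InverseHull M} {m m' : M} :
    (s * t).1 m = some m' ↔ ∃ k, t.1 m = some k ∧ s.1 k = some m' :=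
  PEquiv.trans_eq_some _ _ _ _

theorem star_apply_eq_some {s : InverseHull M} {m m' : M} :
    (star s).1 m = some m' ↔ s.1 m' = some m :=
  PEquiv.eq_some_iff s.1

theorem zero_apply (m : M) : (0 : InverseHull M).1 m = none := rfl

theorem ofMul_apply (m k : M) : (ofMul m).1 k = some (m * k) := rfl

theorem ext_some {s t : InverseHull M}
    (h : ∀ m m', s.1 m = some m' ↔ t.1 m = some m') : s = t :=
  Subtype.ext (PEquiv.ext fun m => Option.ext fun m' => h m m')

theorem ne_zero_iff {s : InverseHull M} : s ≠ 0 ↔ ∃ m m', s.1 m = some m' := by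
  constructor
  · intro h
    by_contra! H
    exact h (ext_some fun m m' => ⟨fun hm => (H m m' hm).elim, fun hm => by
      rw [zero_apply] at hm; cases hm⟩)
  · rintro ⟨m, m', h⟩ rfl
    rw [zero_apply] at h
    cases h

theorem frac_apply_eq_some {a b m m' : M} :
    (frac a b).1 m = some m' ↔ ∃ k, b * k = m ∧ a * k = m' := by
  rw [frac, mul_apply_eq_some]
  simp only [star_apply_eq_some, ofMul_apply, Option.some.injEq]

/-- Left multiplications commute with right multiplications, and this survives inversion and
composition. Hence an element of the hull is determined on `m M` by its value at `m`. -/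
theorem apply_mul {s : InverseHull M} {m m' : M} (h : s.1 m = some m') (k : M) :
    s.1 (m * k) = some (m' * k) := by
  obtain ⟨f, hf⟩ := s
  change f m = some m' at h
  change f (m * k) = some (m' * k)
  induction hf generalizing m m' with
  | leftMul a =>
    cases h
    exact congrArg some (mul_assoc a m k).symm
  | bot => cases h
  | symm _ ih => exact (PEquiv.eq_some_iff _).2 (ih ((PEquiv.eq_some_iff _).1 h))
  | trans _ _ ih₁ ih₂ =>
    obtain ⟨c, hc, hc'⟩ := (PEquiv.trans_eq_some _ _ _ _).1 h
    exact (PEquiv.trans_eq_some _ _ _ _).2 ⟨c * k, ih₁ hc, ih₂ hc'⟩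

/-- If any two elements of `M` with a common right multiple are comparable, then the inverse hull
consists of zero and the partial bijections `b k ↦ a k`. -/
theorem eq_zero_or_eq_frac
    (H : ∀ b c k k' : M, b * k = c * k' → (∃ r, b = c * r) ∨ ∃ r, c = b * r)
    (s : InverseHull M) : s = 0 ∨ ∃ a b, s = frac a b := by
  -- A pointwise description is easier to carry through the induction than an identity of products.
  suffices h : s = 0 ∨ ∃ a b, ∀ m m', s.1 m = some m' ↔ ∃ k, b * k = m ∧ a * k = m' by
    obtain h | ⟨a, b, h⟩ := h
    · exact Or.inl h
    · exact Or.inr ⟨a, b, ext_some fun m m' => by rw [h, frac_apply_eq_some]⟩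
  obtain ⟨f, hf⟩ := s
  change _ ∨ ∃ a b, ∀ m m', f m = some m' ↔ ∃ k, b * k = m ∧ a * k = m'
  induction hf with
  | leftMul a =>
    refine Or.inr ⟨a, 1, fun m m' => ?_⟩
    simp only [one_mul, exists_eq_left]
    exact Option.some_inj
  | bot => exact Or.inl rfl
  | @symm f _ ih =>
    obtain h | ⟨a, b, h⟩ := ih
    · cases congrArg Subtype.val h
      exact Or.inl (Subtype.ext PEquiv.symm_bot)
    · refine Or.inr ⟨b, a, fun m m' => ?_⟩
      rw [PEquiv.eq_some_iff, h]
      simp only [and_comm]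
  | @trans f g _ _ ihf ihg =>
    obtain h | ⟨a, b, h⟩ := ihf
    · cases congrArg Subtype.val h
      exact Or.inl (Subtype.ext (PEquiv.bot_trans _))
    obtain h' | ⟨c, d, h'⟩ := ihg
    · cases congrArg Subtype.val h'
      exact Or.inl (Subtype.ext (PEquiv.trans_bot _))
    have key : ∀ m m', (f.trans g) m = some m' ↔
        ∃ k k', b * k = m ∧ a * k = d * k' ∧ c * k' = m' := by
      intro m m'
      rw [PEquiv.trans_eq_some]
      simp only [h, h']
      constructor
      · rintro ⟨_, ⟨k, hk, rfl⟩, k', hk', hm⟩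
        exact ⟨k, k', hk, hk'.symm, hm⟩
      · rintro ⟨k, k', hk, hkk, hm⟩
        exact ⟨_, ⟨k, hk, rfl⟩, k', hkk.symm, hm⟩
    -- The composite is nonzero only if `a` and `d` have a common right multiple. By `H` one then
    -- divides the other, and the quotient `r` is absorbed into the new numerator or denominator.
    by_cases hc : ∃ k k', a * k = d * k'
    · obtain ⟨k₀, k₀', hc⟩ := hc
      obtain ⟨r, rfl⟩ | ⟨r, rfl⟩ := H _ _ _ _ hc
      · refine Or.inr ⟨c * r, b, fun m m' => ?_⟩
        rw [key]
        constructor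
        · rintro ⟨k, k', hk, hkk, hm⟩
          rw [mul_assoc] at hkk
          exact ⟨k, hk, by rw [mul_assoc, mul_left_cancel hkk, hm]⟩
        · rintro ⟨k, hk, hm⟩
          exact ⟨k, r * k, hk, mul_assoc _ _ _, by rw [← mul_assoc, hm]⟩
      · refine Or.inr ⟨c, b * r, fun m m' => ?_⟩
        rw [key]
        constructor
        · rintro ⟨k, k', hk, hkk, hm⟩
          rw [mul_assoc] at hkk
          exact ⟨k', by rw [mul_assoc, ← mul_left_cancel hkk, hk], hm⟩
        · rintro ⟨k, hk, hm⟩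
          exact ⟨r * k, k, by rw [← mul_assoc, hk], (mul_assoc _ _ _).symm, hm⟩
    · refine Or.inl (Subtype.ext (PEquiv.ext fun m => Option.ext fun m' => ?_))
      rw [key]
      exact ⟨fun ⟨k, k', _, hk, _⟩ => (hc ⟨k, k', hk⟩).elim, fun hm => by cases hm⟩

/-- If `e` sends `m` to `m'`, idempotency makes it send `m'` to `m'` as well, and injectivity
identifies the two. -/
theorem isIdempotentElem_iff {e : InverseHull M} :
    IsIdempotentElem e ↔ ∀ m m', e.1 m = some m' → m' = m := by
  constructor
  · intro he m m' h
    have h2 := h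
    rw [← show e * e = e from he, mul_apply_eq_some] at h2
    obtain ⟨k, hk, hk'⟩ := h2
    obtain rfl : m' = k := Option.some.inj (h.symm.trans hk)
    exact e.1.inj hk' h
  · intro H
    refine ext_some fun m m' => ?_
    rw [mul_apply_eq_some]
    constructor
    · rintro ⟨k, hk, hk'⟩
      rwa [H _ _ hk] at hk'
    · intro h
      cases H _ _ h
      exact ⟨m, h, h⟩

end InverseHull

/-! ### Divisibility in the monoid `X* G` -/

namespace WordMonoid

open SelfSimilarGroup

variable {G X : Type*} [Group G] [MulAction G (List X)] [SelfSimilarGroup G X]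

theorem word_mul (a b : WordMonoid G X) : (a * b).word = a.word ++ a.elt • b.word := rfl

theorem elt_mul (a b : WordMonoid G X) : (a * b).elt = sec a.elt b.word * b.elt := rfl

/-- The group part is invertible, so divisibility only sees the words. -/
theorem exists_mul_eq_iff {b m : WordMonoid G X} :
    (∃ k, m = b * k) ↔ b.word <+: m.word := by
  constructor
  · rintro ⟨k, rfl⟩
    exact ⟨_, rfl⟩
  · rintro ⟨w, hw⟩
    refine ⟨⟨b.elt⁻¹ • w, (sec b.elt (b.elt⁻¹ • w))⁻¹ * m.elt⟩, WordMonoid.ext ?_ ?_⟩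
    · rw [word_mul, smul_inv_smul, hw]
    · rw [elt_mul, mul_inv_cancel_left]

/-- Two prefixes of one word are comparable. This is the hypothesis that `eq_zero_or_eq_frac` needs.
-/
theorem comparable {b c k k' : WordMonoid G X} (h : b * k = c * k') :
    (∃ r, b = c * r) ∨ ∃ r, c = b * r := by
  rw [exists_mul_eq_iff, exists_mul_eq_iff]
  exact List.prefix_or_prefix_of_prefix (exists_mul_eq_iff.1 ⟨k', h⟩) (exists_mul_eq_iff.1 ⟨k, rfl⟩)

variable (G) in
/-- A word as an element of the monoid `X* G`. -/
def ofWord (w : List X) : WordMonoid G X := ⟨w, 1⟩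

theorem ofWord_mul_ofWord (u v : List X) : ofWord G u * ofWord G v = ofWord G (u ++ v) :=
  WordMonoid.ext (by rw [word_mul]; simp [ofWord]) (by rw [elt_mul]; simp [ofWord, sec_one])

end WordMonoid

/-! ### Cylinders, and triviality of a group element at a word -/

namespace SelfSimilarGroup

open InverseHull WordMonoid

variable {G X : Type*} [Group G] [MulAction G (List X)] [SelfSimilarGroup G X]

variable (G) in
/-- The idempotent `w w*`, the identity of `w M`. -/
noncomputable def cylinder (w : List X) : inverseSemigroup G X := frac (ofWord G w) (ofWord G w)

theorem cylinder_apply_eq_some {w : List X} {m m' : WordMonoid G X} :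
    (cylinder G w).1 m = some m' ↔ w <+: m.word ∧ m' = m := by
  rw [cylinder, frac_apply_eq_some]
  constructor
  · rintro ⟨k, rfl, rfl⟩
    exact ⟨⟨_, rfl⟩, rfl⟩
  · rintro ⟨h, rfl⟩
    obtain ⟨k, hk⟩ := (exists_mul_eq_iff (b := ofWord G w)).2 h
    exact ⟨k, hk.symm, hk.symm⟩

theorem cylinder_idem (w : List X) : IsIdempotentElem (cylinder G w) :=
  isIdempotentElem_iff.2 fun _ _ h => (cylinder_apply_eq_some.1 h).2

theorem cylinder_ne_zero (w : List X) : cylinder G w ≠ 0 :=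
  ne_zero_iff.2 ⟨ofWord G w, _, cylinder_apply_eq_some.2 ⟨List.prefix_rfl, rfl⟩⟩

theorem cylinder_mul_apply_eq_some {u v : List X} {m m' : WordMonoid G X} :
    (cylinder G u * cylinder G v).1 m = some m' ↔ u <+: m.word ∧ v <+: m.word ∧ m' = m := by
  rw [mul_apply_eq_some]
  simp only [cylinder_apply_eq_some]
  constructor
  · rintro ⟨_, ⟨h, rfl⟩, h', rfl⟩
    exact ⟨h', h, rfl⟩
  · rintro ⟨h, h', rfl⟩
    exact ⟨m', ⟨h', rfl⟩, h, rfl⟩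

theorem cylinder_mul_eq_left_iff {u v : List X} :
    cylinder G u * cylinder G v = cylinder G u ↔ v <+: u := by
  constructor
  · intro h
    have : (cylinder G u).1 (ofWord G u) = some (ofWord G u) :=
      cylinder_apply_eq_some.2 ⟨List.prefix_rfl, rfl⟩
    rw [← h, cylinder_mul_apply_eq_some] at this
    exact this.2.1
  · intro h
    refine ext_some fun m m' => ?_
    rw [cylinder_mul_apply_eq_some, cylinder_apply_eq_some]
    exact ⟨fun h' => ⟨h'.1, h'.2.2⟩, fun h' => ⟨h'.1, h.trans h'.1, h'.2⟩⟩

theorem cylinder_mul_ne_zero_iff {u v : List X} :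
    cylinder G u * cylinder G v ≠ 0 ↔ u <+: v ∨ v <+: u := by
  rw [ne_zero_iff]
  simp only [cylinder_mul_apply_eq_some]
  constructor
  · rintro ⟨m, m', h, h', -⟩
    exact List.prefix_or_prefix_of_prefix h h'
  · rintro (h | h)
    · exact ⟨ofWord G v, _, h, List.prefix_rfl, rfl⟩
    · exact ⟨ofWord G u, _, List.prefix_rfl, h, rfl⟩

theorem cylinder_injective : Function.Injective (cylinder G : List X → _) := by
  intro u v h
  have h1 : v <+: u := cylinder_mul_eq_left_iff.1 (by rw [← h]; exact cylinder_idem (G := G) u)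
  have h2 : u <+: v := cylinder_mul_eq_left_iff.1 (by rw [h]; exact cylinder_idem (G := G) v)
  exact h2.eq_of_length_le h1.length_le

/-- The fraction `frac a b` sends `b` to `a`, so idempotency forces `a = b`; and `a M` depends only
on the word of `a`. -/
theorem eq_cylinder_of_idem {e : inverseSemigroup G X} (he : IsIdempotentElem e) (h0 : e ≠ 0) :
    ∃ w, e = cylinder G w := by
  obtain h | ⟨a, b, rfl⟩ := eq_zero_or_eq_frac (fun _ _ _ _ => comparable) e
  · exact (h0 h).elim
  have hab : a = b :=
    isIdempotentElem_iff.1 he b a (frac_apply_eq_some.2 ⟨1, mul_one b, mul_one a⟩)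
  subst hab
  refine ⟨a.word, ext_some fun m m' => ?_⟩
  rw [frac_apply_eq_some, cylinder_apply_eq_some, ← exists_mul_eq_iff]
  constructor
  · rintro ⟨k, rfl, rfl⟩
    exact ⟨⟨k, rfl⟩, rfl⟩
  · rintro ⟨⟨k, rfl⟩, rfl⟩
    exact ⟨k, rfl, rfl⟩

/-- Two elements of the inverse semigroup that agree at `w` agree below `w`. -/
theorem mul_cylinder_eq {s t : inverseSemigroup G X} {w : List X} {m : WordMonoid G X}
    (hs : s.1 (ofWord G w) = some m) (ht : t.1 (ofWord G w) = some m) :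
    s * cylinder G w = t * cylinder G w := by
  have key : ∀ {r : inverseSemigroup G X}, r.1 (ofWord G w) = some m → ∀ n n',
      (r * cylinder G w).1 n = some n' ↔ ∃ k, n = ofWord G w * k ∧ n' = m * k := by
    intro r hr n n'
    rw [mul_apply_eq_some]
    simp only [cylinder_apply_eq_some]
    constructor
    · rintro ⟨_, ⟨h, rfl⟩, h'⟩
      obtain ⟨k, rfl⟩ := (exists_mul_eq_iff (b := ofWord G w)).2 h
      exact ⟨k, rfl, Option.some.inj (h'.symm.trans (apply_mul hr k))⟩
    · rintro ⟨k, rfl, rfl⟩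
      exact ⟨_, ⟨⟨_, rfl⟩, rfl⟩, apply_mul hr k⟩
  exact ext_some fun n n' => (key hs n n').trans (key ht n n').symm

/-- `g` fixes `w` and has trivial section at `w`. -/
def TrivialAt (g : G) (w : List X) : Prop := g • w = w ∧ sec g w = 1

theorem trivialAt_append {g : G} {u v : List X} (h : TrivialAt g u) : TrivialAt g (u ++ v) := by
  refine ⟨?_, ?_⟩
  · rw [smul_append, h.1, h.2, one_smul]
  · rw [sec_append, h.2, sec_one]

theorem trivialAt_append_iff {g : G} {u v : List X} :
    TrivialAt g (u ++ v) ↔ g • u = u ∧ TrivialAt (sec g u) v := by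
  rw [TrivialAt, TrivialAt, smul_append, sec_append, and_assoc.symm]
  refine and_congr_left fun _ => ⟨fun h => ?_, fun h => by rw [h.1, h.2]⟩
  exact List.append_inj h (length_smul g u)

theorem trivialAt_inv_mul {g h : G} {w : List X} :
    TrivialAt (h⁻¹ * g) w ↔ g • w = h • w ∧ sec g w = sec h w := by
  have key : g • w = h • w → sec (h⁻¹ * g) w = (sec h w)⁻¹ * sec g w := by
    intro hw
    -- Taking sections of `h⁻¹ h = 1` at `w` shows that `h⁻¹` has section `(sec h w)⁻¹` at `h • w`.
    have h1 := sec_mul h⁻¹ h w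
    rw [inv_mul_cancel, sec_one] at h1
    rw [sec_mul, hw, eq_inv_of_mul_eq_one_left h1.symm]
  rw [TrivialAt, mul_smul, inv_smul_eq_iff]
  refine and_congr_right fun hw => ?_
  rw [key hw, inv_mul_eq_one, eq_comm]

/-- The action preserves length, so the two images of `m.word` have equal length and split off from
the right. This reduces coincidences in `S` to a single element of `G`. -/
theorem mul_eq_mul_iff {a c m : WordMonoid G X} :
    a * m = c * m ↔ a.word = c.word ∧ TrivialAt (c.elt⁻¹ * a.elt) m.word := by
  rw [trivialAt_inv_mul, WordMonoid.ext_iff, word_mul, word_mul, elt_mul, elt_mul,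
    mul_left_inj, ← and_assoc]
  refine and_congr_left fun _ => ⟨fun h => ?_, fun h => by rw [h.1, h.2]⟩
  exact List.append_inj' h (by rw [length_smul, length_smul])

end SelfSimilarGroup

/-! ### Separating germs in a tight groupoid -/

section Separation

open InverseSemigroupWithZero

variable {S : Type*} [InverseSemigroupWithZero S]

theorem TightFilter.isOpen_setOf_mem (e : S) : IsOpen {F : TightFilter S | e ∈ F} := by
  by_cases he : IsIdempotentElem e
  · exact TopologicalSpace.isOpen_generateFrom_of_mem ⟨e, he, Or.inl rfl⟩
  · convert isOpen_empty
    exact Set.eq_empty_of_forall_notMem fun F hF => he (F.idem e hF)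

theorem TightFilter.isOpen_setOf_notMem {e : S} (he : IsIdempotentElem e) :
    IsOpen {F : TightFilter S | e ∉ F} :=
  TopologicalSpace.isOpen_generateFrom_of_mem ⟨e, he, Or.inr rfl⟩

instance : T2Space (TightFilter S) := by
  refine ⟨fun F F' h => ?_⟩
  have sep : ∀ {F F' : TightFilter S} {e : S}, e ∈ F → e ∉ F' →
      ∃ u v, IsOpen u ∧ IsOpen v ∧ F ∈ u ∧ F' ∈ v ∧ Disjoint u v := fun {F F' e} he he' =>
    ⟨_, _, TightFilter.isOpen_setOf_mem e, TightFilter.isOpen_setOf_notMem (F.idem e he), he, he',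
      Set.disjoint_left.2 fun _ h h' => h' h⟩
  by_cases hs : ∃ e, e ∈ F ∧ e ∉ F'
  · obtain ⟨e, he, he'⟩ := hs
    exact sep he he'
  · push Not at hs
    have : ∃ e, e ∈ F' ∧ e ∉ F := by
      by_contra! H
      exact h (TightFilter.ext (Set.ext fun e => ⟨hs e, H e⟩))
    obtain ⟨e, he, he'⟩ := this
    obtain ⟨u, v, hu, hv, h1, h2, h3⟩ := sep he he'
    exact ⟨v, u, hv, hu, h2, h1, h3.symm⟩

namespace TightGroupoid

/-- The basic open set `Θ(s, U)`. -/
def basicOpen (s : S) (U : Set (TightFilter S)) : Set (TightGroupoid S) :=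
  {γ | ∃ (F : TightFilter S) (h : star s * s ∈ F), F ∈ U ∧ γ = germ s F h}

theorem isOpen_basicOpen (s : S) {U : Set (TightFilter S)} (hU : IsOpen U) :
    IsOpen (basicOpen s U) :=
  TopologicalSpace.isOpen_generateFrom_of_mem ⟨s, U, hU, rfl⟩

theorem continuous_source : Continuous (source : TightGroupoid S → TightFilter S) := by
  refine continuous_def.2 fun U hU => ?_
  have : source ⁻¹' U = ⋃ s : S, basicOpen s U := by
    ext γ
    rw [Set.mem_iUnion]
    constructor
    · intro h
      induction γ using Quotient.inductionOn with
      | h p => exact ⟨p.elt, p.filter, p.dom, h, rfl⟩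
    · rintro ⟨s, F, h, hF, rfl⟩
      exact hF
  rw [this]
  exact isOpen_iUnion fun s => isOpen_basicOpen s hU

theorem exists_of_germ_eq_germ {s t : S} {F F' : TightFilter S} {hs : star s * s ∈ F}
    {ht : star t * t ∈ F'} (h : germ s F hs = germ t F' ht) :
    F = F' ∧ ∃ e ∈ F, s * e = t * e :=
  Quotient.exact h

/-- The local section `F ↦ [s, F]` of an element `s` that is defined everywhere is continuous. -/
theorem continuous_germ (s : S) (hs : ∀ F : TightFilter S, star s * s ∈ F) :
    Continuous fun F => germ s F (hs F) := by
  refine continuous_generateFrom_iff.2 ?_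
  rintro _ ⟨t, U, hU, rfl⟩
  -- Equality of germs is witnessed by an idempotent `e ∈ F` with `s * e = t * e`, and containing a
  -- given `e` is an open condition.
  have : (fun F => germ s F (hs F)) ⁻¹' {γ | ∃ (F : TightFilter S) (h : star t * t ∈ F),
      F ∈ U ∧ γ = germ t F h} =
      ⋃ e : {e : S // s * e = t * e}, {F | star t * t ∈ F} ∩ U ∩ {F | e.1 ∈ F} := by
    ext F
    simp only [Set.mem_preimage, Set.mem_ofPred_eq, Set.mem_iUnion, Set.mem_inter_iff]
    constructor
    · rintro ⟨F', ht, hF', h⟩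
      obtain ⟨rfl, e, he, hse⟩ := exists_of_germ_eq_germ h
      exact ⟨⟨e, hse⟩, ⟨ht, hF'⟩, he⟩
    · rintro ⟨⟨e, hse⟩, ⟨ht, hF⟩, he⟩
      exact ⟨F, ht, hF, germ_eq e he hse⟩
  rw [this]
  exact isOpen_iUnion fun e => ((TightFilter.isOpen_setOf_mem _).inter hU).inter
    (TightFilter.isOpen_setOf_mem _)

/-- The tight groupoid is Hausdorff if any two elements of `S` whose germs at `F` differ have
different germs at all points of a neighbourhood of `F`. -/
theorem t2Space_of_separated (H : ∀ (s t : S) (F : TightFilter S), star s * s ∈ F →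
    star t * t ∈ F → (∀ e ∈ F, s * e ≠ t * e) →
    ∃ U : Set (TightFilter S), IsOpen U ∧ F ∈ U ∧ ∀ F' ∈ U, ∀ e ∈ F', s * e ≠ t * e) :
    T2Space (TightGroupoid S) := by
  refine ⟨fun γ δ h => ?_⟩
  -- Germs with different sources are separated by `source`, because the space of tight filters is
  -- Hausdorff. Only a common source needs `H`.
  by_cases hγδ : source γ = source δ
  · induction γ using Quotient.inductionOn with
    | h p =>
    induction δ using Quotient.inductionOn with
    | h q =>
    obtain ⟨s, F, hs⟩ := p
    obtain ⟨t, F', ht⟩ := q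
    obtain rfl : F = F' := hγδ
    obtain ⟨U, hU, hF, hne⟩ := H s t F hs ht fun e he hst => h (germ_eq e he hst)
    refine ⟨basicOpen s U, basicOpen t U, isOpen_basicOpen s hU, isOpen_basicOpen t hU,
      ⟨F, hs, hF, rfl⟩, ⟨F, ht, hF, rfl⟩, Set.disjoint_left.2 ?_⟩
    rintro _ ⟨F₁, h₁, hF₁, rfl⟩ ⟨F₂, h₂, hF₂, hst⟩
    obtain ⟨-, e, he, hse⟩ := exists_of_germ_eq_germ hst
    exact hne F₁ hF₁ e he hse
  · exact separated_by_continuous continuous_source hγδ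

end TightGroupoid

end Separation

/-! ### Infinite words as tight filters, and the consequence of Hausdorffness -/

namespace SelfSimilarGroup

open InverseHull WordMonoid

/-- The word formed by the first `n` letters of an infinite word. -/
def firstLetters {X : Type*} (ξ : ℕ → X) (n : ℕ) : List X := (List.range n).map ξ

section FirstLetters

variable {X : Type*}

theorem length_firstLetters (ξ : ℕ → X) (n : ℕ) : (firstLetters ξ n).length = n := by
  simp [firstLetters]

theorem take_firstLetters (ξ : ℕ → X) {m n : ℕ} (h : m ≤ n) :
    (firstLetters ξ n).take m = firstLetters ξ m := by
  rw [firstLetters, ← List.map_take, List.take_range, min_eq_left h, firstLetters]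

theorem prefix_firstLetters_iff {ξ : ℕ → X} {u : List X} {n : ℕ} :
    u <+: firstLetters ξ n ↔ u.length ≤ n ∧ u = firstLetters ξ u.length := by
  constructor
  · intro h
    have hl : u.length ≤ n := by simpa only [length_firstLetters] using h.length_le
    exact ⟨hl, by rw [← take_firstLetters ξ hl]; exact List.prefix_iff_eq_take.1 h⟩
  · rintro ⟨hl, h⟩
    rw [List.prefix_iff_eq_take, take_firstLetters ξ hl]
    exact h

theorem firstLetters_mono (ξ : ℕ → X) {m n : ℕ} (h : m ≤ n) :
    firstLetters ξ m <+: firstLetters ξ n := by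
  rw [prefix_firstLetters_iff, length_firstLetters]
  exact ⟨h, rfl⟩

theorem exists_firstLetters_eq [Nonempty X] (w : List X) :
    ∃ ξ : ℕ → X, firstLetters ξ w.length = w := by
  refine ⟨fun i => w.getD i (Classical.arbitrary X), List.ext_getElem ?_ fun i h₁ h₂ => ?_⟩
  · rw [length_firstLetters]
  · simp [firstLetters, h₂]

theorem isOpen_firstLetters [TopologicalSpace X] [DiscreteTopology X] (n : ℕ)
    (P : List X → Prop) : IsOpen {ξ : ℕ → X | P (firstLetters ξ n)} := by
  refine isOpen_iff_mem_nhds.2 fun ξ hξ => ?_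
  have h : ∀ i ∈ Finset.range n, ∀ᶠ η : ℕ → X in nhds ξ, η i = ξ i := by
    intro i _
    have hi : Continuous fun η : ℕ → X => η i := continuous_apply i
    exact ((isOpen_discrete {ξ i}).preimage hi).mem_nhds (Set.mem_singleton (ξ i))
  filter_upwards [(Filter.eventually_all_finset _).2 h] with η hη
  have : firstLetters η n = firstLetters ξ n :=
    List.map_congr_left fun i hi => hη i (Finset.mem_range.2 (List.mem_range.1 hi))
  change P _
  rw [this]
  exact hξ

end FirstLetters

variable {G X : Type*} [Group G] [MulAction G (List X)] [SelfSimilarGroup G X]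

variable (G) in
/-- The tight filter of an infinite word: the idempotents `w w*` for its finite initial words. -/
noncomputable def pathFilter (ξ : ℕ → X) : TightFilter (inverseSemigroup G X) where
  carrier := Set.range fun n => cylinder G (firstLetters ξ n)
  idem := by
    rintro _ ⟨n, rfl⟩
    exact cylinder_idem _
  nonempty := Set.range_nonempty _
  zero_notMem := by
    rintro ⟨n, hn⟩
    exact cylinder_ne_zero _ hn
  mul_mem := by
    rintro _ ⟨n, rfl⟩ _ ⟨m, rfl⟩
    obtain h | h := le_total n m
    · exact ⟨m, by
        rw [InverseSemigroupWithZero.idem_comm (cylinder_idem _) (cylinder_idem _)]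
        exact (cylinder_mul_eq_left_iff.2 (firstLetters_mono ξ h)).symm⟩
    · exact ⟨n, (cylinder_mul_eq_left_iff.2 (firstLetters_mono ξ h)).symm⟩
  mem_of_le := by
    rintro _ ⟨n, rfl⟩ f hf h
    have hf0 : f ≠ 0 := by
      rintro rfl
      rw [mul_zero] at h
      exact cylinder_ne_zero _ h.symm
    obtain ⟨u, rfl⟩ := eq_cylinder_of_idem hf hf0
    exact ⟨u.length, congrArg _ (prefix_firstLetters_iff.1 (cylinder_mul_eq_left_iff.1 h)).2.symm⟩
  tight := by
    rintro _ ⟨n, rfl⟩ C ⟨hC, hcov⟩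
    -- `N c` is the length of the word of `c`: once a prefix of `ξ` is that long, its cylinder meets
    -- `c` only if the word of `c` is itself a prefix of `ξ`.
    have hex : ∀ c : inverseSemigroup G X, ∃ N, c ∈ C → ∀ m, N ≤ m →
        cylinder G (firstLetters ξ m) * c ≠ 0 →
        c ∈ Set.range fun n => cylinder G (firstLetters ξ n) := by
      intro c
      by_cases h : c ∈ C ∧ c ≠ 0
      · obtain ⟨u, rfl⟩ := eq_cylinder_of_idem (hC c h.1).1 h.2
        refine ⟨u.length, fun _ m hm hne => ?_⟩
        have hu : u <+: firstLetters ξ m := by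
          obtain h' | h' := cylinder_mul_ne_zero_iff.1 hne
          · rw [h'.eq_of_length_le (by rwa [length_firstLetters])]
          · exact h'
        exact ⟨u.length, congrArg _ (prefix_firstLetters_iff.1 hu).2.symm⟩
      · refine ⟨0, fun hc m _ hne => (h ⟨hc, ?_⟩).elim⟩
        rintro rfl
        exact hne (mul_zero _)
    choose N hN using hex
    -- The sum makes the prefix longer than all the words in the cover at once.
    obtain ⟨c, hc, hne⟩ := hcov (cylinder G (firstLetters ξ (n + ∑ c ∈ C, N c)))
      (cylinder_idem _) (cylinder_ne_zero _)
      (cylinder_mul_eq_left_iff.2 (firstLetters_mono ξ (Nat.le_add_right _ _)))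
    exact ⟨c, hc, hN c hc _
      ((Finset.single_le_sum (f := N) (fun _ _ => Nat.zero_le _) hc).trans (Nat.le_add_left _ _))
      hne⟩

theorem cylinder_mem_pathFilter {ξ : ℕ → X} {u : List X} :
    cylinder G u ∈ pathFilter G ξ ↔ firstLetters ξ u.length = u := by
  constructor
  · rintro ⟨n, hn⟩
    rw [← cylinder_injective hn, length_firstLetters]
  · intro h
    exact ⟨u.length, congrArg _ h⟩

theorem continuous_pathFilter [TopologicalSpace X] [DiscreteTopology X] :
    Continuous (pathFilter G : (ℕ → X) → _) := by
  refine continuous_generateFrom_iff.2 ?_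
  rintro _ ⟨e, he, h⟩
  by_cases h0 : e = 0
  · have hmem : ∀ ξ : ℕ → X, e ∉ pathFilter G ξ := fun ξ => h0 ▸ (pathFilter G ξ).zero_notMem
    obtain rfl | rfl := h
    · convert isOpen_empty
      exact Set.eq_empty_of_forall_notMem hmem
    · convert isOpen_univ
      exact Set.eq_univ_of_forall hmem
  · obtain ⟨u, rfl⟩ := eq_cylinder_of_idem he h0
    obtain rfl | rfl := h
    · simp only [Set.preimage_ofPred_eq, cylinder_mem_pathFilter]
      exact isOpen_firstLetters u.length fun v => v = u
    · simp only [Set.preimage_ofPred_eq, cylinder_mem_pathFilter]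
      exact isOpen_firstLetters u.length fun v => v ≠ u

theorem star_ofMul_mul (g : G) :
    star (ofMul (⟨[], g⟩ : WordMonoid G X)) * ofMul ⟨[], g⟩ = cylinder G [] := by
  refine ext_some fun m m' => ?_
  rw [mul_apply_eq_some, cylinder_apply_eq_some]
  simp only [star_apply_eq_some, ofMul_apply, Option.some.injEq, List.nil_prefix, true_and]
  constructor
  · rintro ⟨_, rfl, h⟩
    exact mul_left_cancel h
  · rintro rfl
    exact ⟨_, rfl, rfl⟩

/-- The domain idempotent is the cylinder of the empty word, the greatest idempotent. Elements of
`G` thus have a germ at every tight filter, as `continuous_germ` requires. -/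
theorem star_ofMul_mul_mem (g : G) (F : TightFilter (inverseSemigroup G X)) :
    star (ofMul (⟨[], g⟩ : WordMonoid G X)) * ofMul ⟨[], g⟩ ∈ F := by
  obtain ⟨e, he⟩ := F.nonempty
  obtain ⟨u, rfl⟩ := eq_cylinder_of_idem (F.idem e he) fun h => F.zero_notMem (h ▸ he)
  rw [star_ofMul_mul]
  exact F.mem_of_le _ he _ (cylinder_idem _) (cylinder_mul_eq_left_iff.2 List.nil_prefix)

theorem ofMul_mul_ofWord_eq_iff {g : G} {w : List X} :
    (⟨[], g⟩ : WordMonoid G X) * ofWord G w = ⟨[], 1⟩ * ofWord G w ↔ TrivialAt g w := by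
  rw [mul_eq_mul_iff]
  simp [ofWord]

/-- The filter of `ξ` contains only cylinders of prefixes, and two elements that agree on such a
cylinder can be compared at the prefix itself. -/
theorem germ_eq_germ_one_iff {g : G} {ξ : ℕ → X} :
    TightGroupoid.germ _ (pathFilter G ξ) (star_ofMul_mul_mem g _) =
      TightGroupoid.germ _ (pathFilter G ξ) (star_ofMul_mul_mem 1 _) ↔
    ∃ n, TrivialAt g (firstLetters ξ n) := by
  constructor
  · intro h
    obtain ⟨_, ⟨n, rfl⟩, h⟩ := TightGroupoid.exists_of_germ_eq h
    refine ⟨n, ofMul_mul_ofWord_eq_iff.1 ?_⟩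
    have hc : (cylinder G (firstLetters ξ n)).1 (ofWord G (firstLetters ξ n)) = some _ :=
      cylinder_apply_eq_some.2 ⟨List.prefix_rfl, rfl⟩
    have h1 := mul_apply_eq_some.2 ⟨_, hc, ofMul_apply ⟨[], g⟩ _⟩
    have h2 := mul_apply_eq_some.2 ⟨_, hc, ofMul_apply ⟨[], 1⟩ _⟩
    change ofMul (⟨[], g⟩ : WordMonoid G X) * cylinder G (firstLetters ξ n) =
      ofMul ⟨[], 1⟩ * cylinder G (firstLetters ξ n) at h
    rw [h, h2] at h1
    exact (Option.some.inj h1).symm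
  · rintro ⟨n, hn⟩
    exact TightGroupoid.germ_eq _ ⟨n, rfl⟩
      (mul_cylinder_eq (ofMul_apply _ _) (by rw [ofMul_mul_ofWord_eq_iff.2 hn, ofMul_apply]))

/-- In a Hausdorff groupoid the equalizer of the continuous sections `ξ ↦ [g, ξ]` and `ξ ↦ [1, ξ]`
is closed in the compact space of infinite words. It is also the increasing union of the open sets
where `g` is trivial at the first `n` letters, so one `n` suffices. -/
theorem exists_trivialAt_of_t2Space [Finite X] [Nonempty X]
    [T2Space (TightGroupoid (inverseSemigroup G X))] (g : G) :
    ∃ n, ∀ w v : List X, w.length = n → TrivialAt g (w ++ v) → TrivialAt g w := by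
  let _ : TopologicalSpace X := ⊥
  have : DiscreteTopology X := ⟨rfl⟩
  have hclosed : IsClosed {ξ : ℕ → X | ∃ n, TrivialAt g (firstLetters ξ n)} := by
    have := isClosed_eq
      ((TightGroupoid.continuous_germ _ (star_ofMul_mul_mem g)).comp
        (continuous_pathFilter (G := G) (X := X)))
      ((TightGroupoid.continuous_germ _ (star_ofMul_mul_mem 1)).comp
        (continuous_pathFilter (G := G) (X := X)))
    simp only [Function.comp_apply, germ_eq_germ_one_iff] at this
    exact this
  obtain ⟨n, hn⟩ := hclosed.isCompact.elim_directed_cover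
    (fun n => {ξ : ℕ → X | TrivialAt g (firstLetters ξ n)})
    (fun n => isOpen_firstLetters n (TrivialAt g)) (fun ξ ⟨n, h⟩ => Set.mem_iUnion.2 ⟨n, h⟩)
    (directed_of_isDirected_le fun m n hmn ξ h => by
      obtain ⟨v, hv⟩ := firstLetters_mono ξ hmn
      change TrivialAt g _
      rw [← hv]
      exact trivialAt_append h)
  refine ⟨n, fun w v hw h => ?_⟩
  -- Any infinite continuation of `w ++ v` lies in the equalizer, and its first `n` letters are `w`.
  obtain ⟨ξ, hξ⟩ := exists_firstLetters_eq (w ++ v)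
  have := @hn ξ ⟨_, by rwa [hξ]⟩
  have hw' := (prefix_firstLetters_iff.1 (hξ ▸ List.prefix_append w v)).2
  change TrivialAt g _ at this
  rwa [← hw, ← hw'] at this

/-- The cylinders of the one-letter extensions of a word cover its cylinder, so tightness lengthens
the word one letter at a time. -/
theorem exists_cylinder_mem [Finite X] [Nonempty X] {F : TightFilter (inverseSemigroup G X)} {v : List X}
    (hv : cylinder G v ∈ F) (n : ℕ) : ∃ z : List X, z.length = n ∧ cylinder G (v ++ z) ∈ F := by
  classical
  induction n with
  | zero => exact ⟨[], rfl, by rwa [List.append_nil]⟩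
  | succ n ih =>
    obtain ⟨z, hz, hF⟩ := ih
    have := Fintype.ofFinite X
    obtain ⟨c, hc, hcF⟩ := F.tight _ hF
      (Finset.univ.image fun x => cylinder G (v ++ z ++ [x])) (by
        refine ⟨fun c hc => ?_, fun f hf hf0 hle => ?_⟩
        · obtain ⟨x, -, rfl⟩ := Finset.mem_image.1 hc
          exact ⟨cylinder_idem _, cylinder_mul_eq_left_iff.2 (List.prefix_append _ _)⟩
        · obtain ⟨u, rfl⟩ := eq_cylinder_of_idem hf hf0
          obtain ⟨y, rfl⟩ := cylinder_mul_eq_left_iff.1 hle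
          -- The full cylinder meets every child, so any letter serves; a proper subcylinder meets
          -- the child given by its next letter.
          cases y with
          | nil =>
            refine ⟨_, Finset.mem_image_of_mem _ (Finset.mem_univ (Classical.arbitrary X)),
              cylinder_mul_ne_zero_iff.2 (Or.inl ?_)⟩
            rw [List.append_nil]
            exact List.prefix_append _ _
          | cons x y =>
            refine ⟨_, Finset.mem_image_of_mem _ (Finset.mem_univ x),
              cylinder_mul_ne_zero_iff.2 (Or.inr ⟨y, ?_⟩)⟩
            simp)
    obtain ⟨x, -, rfl⟩ := Finset.mem_image.1 hc
    exact ⟨z ++ [x], by simp [hz], by rwa [← List.append_assoc]⟩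

end SelfSimilarGroup

/-! ### The Hausdorff criterion -/

namespace SelfSimilarGroup

open InverseHull WordMonoid

variable {G X : Type*} [Group G] [MulAction G (List X)] [SelfSimilarGroup G X]

theorem exists_cylinder_mem_of_dom {s : inverseSemigroup G X}
    {F : TightFilter (inverseSemigroup G X)} (hs : star s * s ∈ F) :
    ∃ u, cylinder G u ∈ F ∧ ∃ a, s.1 (ofWord G u) = some a := by
  obtain ⟨u, hu⟩ := eq_cylinder_of_idem (F.idem _ hs) fun h => F.zero_notMem (h ▸ hs)
  rw [hu] at hs
  refine ⟨u, hs, ?_⟩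
  have h : (cylinder G u).1 (ofWord G u) = some _ :=
    cylinder_apply_eq_some.2 ⟨List.prefix_rfl, rfl⟩
  rw [← hu, mul_apply_eq_some] at h
  obtain ⟨a, ha, -⟩ := h
  exact ⟨a, ha⟩

theorem exists_apply_ofWord_eq_some {s : inverseSemigroup G X} {u v : List X}
    (h : u <+: v) (hs : ∃ a, s.1 (ofWord G u) = some a) : ∃ a, s.1 (ofWord G v) = some a := by
  obtain ⟨w, rfl⟩ := h
  obtain ⟨a, ha⟩ := hs
  exact ⟨_, by rw [← ofWord_mul_ofWord]; exact apply_mul ha _⟩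

/-- Below a common cylinder `v` in their domains, `s` and `t` are `v k ↦ a k` and `v k ↦ c k`. If
their germs differ at `F`, they differ at all filters containing `v z`, where `z` has the length `n`
belonging to `c.elt⁻¹ * a.elt`. -/
theorem t2Space_of_exists_trivialAt [Finite X] [Nonempty X]
    (H : ∀ g : G, ∃ n, ∀ w v : List X, w.length = n → TrivialAt g (w ++ v) → TrivialAt g w) :
    T2Space (TightGroupoid (inverseSemigroup G X)) := by
  refine TightGroupoid.t2Space_of_separated fun s t F hs ht hne => ?_
  obtain ⟨v, hv, ⟨a, ha⟩, ⟨c, hc⟩⟩ : ∃ v, cylinder G v ∈ F ∧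
      (∃ a, s.1 (ofWord G v) = some a) ∧ ∃ c, t.1 (ofWord G v) = some c := by
    obtain ⟨u, hu, hsu⟩ := exists_cylinder_mem_of_dom hs
    obtain ⟨u', hu', htu⟩ := exists_cylinder_mem_of_dom ht
    have h0 : cylinder G u * cylinder G u' ≠ 0 := fun h =>
      F.zero_notMem (h ▸ F.mul_mem _ hu _ hu')
    obtain h | h := cylinder_mul_ne_zero_iff.1 h0
    · exact ⟨u', hu', exists_apply_ofWord_eq_some h hsu, htu⟩
    · exact ⟨u, hu, hsu, exists_apply_ofWord_eq_some h htu⟩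
  obtain ⟨n, hn⟩ := H (c.elt⁻¹ * a.elt)
  obtain ⟨z, hz, hvz⟩ := exists_cylinder_mem hv n
  refine ⟨_, TightFilter.isOpen_setOf_mem (cylinder G (v ++ z)), hvz, fun F' hF' e he hst => ?_⟩
  -- If the germs agreed at a nearby `F'`, then `s` and `t` would agree at some right multiple of `v
  -- z`, since `e` meets this cylinder.
  have h0 : cylinder G (v ++ z) * e ≠ 0 := fun h => F'.zero_notMem (h ▸ F'.mul_mem _ hF' _ he)
  obtain ⟨m, m', hm⟩ := ne_zero_iff.1 h0
  obtain ⟨k, hk, hk'⟩ := mul_apply_eq_some.1 hm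
  obtain ⟨hpre, rfl⟩ := cylinder_apply_eq_some.1 hk'
  obtain rfl := isIdempotentElem_iff.1 (F'.idem e he) _ _ hk
  obtain ⟨k, rfl⟩ := (exists_mul_eq_iff (b := ofWord G (v ++ z))).2 hpre
  rw [← ofWord_mul_ofWord, mul_assoc] at hk
  have h1 := mul_apply_eq_some.2 ⟨_, hk, apply_mul ha _⟩
  have h2 := mul_apply_eq_some.2 ⟨_, hk, apply_mul hc _⟩
  rw [hst, h2] at h1
  obtain ⟨hword, htriv⟩ := mul_eq_mul_iff.1 (Option.some.inj h1).symm
  -- The choice of `n` moves the agreement up to `v z` itself, whose cylinder lies in `F`; this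
  -- contradicts `hne`.
  have hz' : a * ofWord G z = c * ofWord G z := mul_eq_mul_iff.2 ⟨hword, hn z _ hz htriv⟩
  refine hne _ hvz (mul_cylinder_eq (m := a * ofWord G z) ?_ ?_)
  · rw [← ofWord_mul_ofWord]
    exact apply_mul ha _
  · rw [← ofWord_mul_ofWord, hz']
    exact apply_mul hc _

theorem t2Space_iff [Finite X] [Nonempty X] :
    T2Space (TightGroupoid (inverseSemigroup G X)) ↔
      ∀ g : G, ∃ n, ∀ w v : List X, w.length = n → TrivialAt g (w ++ v) → TrivialAt g w :=
  ⟨fun _ => exists_trivialAt_of_t2Space, t2Space_of_exists_trivialAt⟩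

end SelfSimilarGroup

/-! ### The simplicity graph -/

namespace FiniteAutomaton

open SelfSimilarGroup

variable {G X : Type*} [Group G] [MulAction G (List X)] [SelfSimilarGroup G X]
  (A : FiniteAutomaton G X)

/-- Unwinding the recursion, `≡_w` records the image of `w` and the section at `w`. This is the
bridge from the graph to the criterion. -/
theorem wordRel_iff {w : List X} {g h : A.carrier} :
    A.wordRel w g h ↔ TrivialAt (h.1⁻¹ * g.1) w := by
  rw [trivialAt_inv_mul]
  induction w generalizing g h with
  | nil =>
    rw [smul_nil, smul_nil]
    exact ⟨fun e => ⟨rfl, congrArg Subtype.val e⟩, fun e => Subtype.ext e.2⟩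
  | cons x w ih =>
    change (g.1 • [x] = h.1 • [x] ∧ A.wordRel w (A.next g x) (A.next h x)) ↔ _
    have hcons : ∀ k : G, k • (x :: w) = k • [x] ++ sectionLetter k x • w := fun k =>
      smul_append k [x] w
    rw [ih, hcons, hcons, ← and_assoc]
    refine and_congr_left fun _ => ⟨fun e => ?_, fun e => ?_⟩
    · rw [e.1]
      exact congrArg _ e.2
    · exact List.append_inj e (by rw [length_smul, length_smul])

theorem ncard_reachSet_eq_one_iff {w : List X} :
    (A.reachSet w).ncard = 1 ↔ ∀ v, A.wordRel (w ++ v) = A.wordRel w := by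
  rw [Set.ncard_eq_one]
  constructor
  · rintro ⟨r, hr⟩ v
    have h : ∀ v, A.vertex (w ++ v) = r := fun v => by
      rw [← Set.mem_singleton_iff, ← hr]
      exact ⟨v, rfl⟩
    have := (h v).trans (h []).symm
    rw [List.append_nil] at this
    exact congrArg Subtype.val this
  · intro h
    refine ⟨A.vertex w, Set.eq_singleton_iff_unique_mem.2 ⟨⟨[], by rw [List.append_nil]⟩, ?_⟩⟩
    rintro _ ⟨v, rfl⟩
    exact Subtype.ext (h v)

/-- Only finitely many quotients `h⁻¹ g` of states occur. The sum of their bounds dominates each of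
them, and triviality at a prefix passes to the longer word. -/
theorem exists_ncard_reachSet_eq_one
    (H : ∀ g : G, ∃ n, ∀ w v : List X, w.length = n → TrivialAt g (w ++ v) → TrivialAt g w) :
    ∃ n : ℕ, ∀ w : List X, w.length = n → (A.reachSet w).ncard = 1 := by
  choose N hN using H
  have := A.finite.fintype
  refine ⟨∑ p : A.carrier × A.carrier, N (p.2.1⁻¹ * p.1.1), fun w hw => ?_⟩
  refine A.ncard_reachSet_eq_one_iff.2 fun v => Setoid.ext fun g h => ?_
  rw [wordRel_iff, wordRel_iff]
  refine ⟨fun ht => ?_, trivialAt_append⟩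
  have hle : N (h.1⁻¹ * g.1) ≤ w.length := hw ▸ Finset.single_le_sum
    (f := fun p : A.carrier × A.carrier => N (p.2.1⁻¹ * p.1.1)) (fun _ _ => Nat.zero_le _)
    (Finset.mem_univ (g, h))
  rw [← List.take_append_drop (N (h.1⁻¹ * g.1)) w, List.append_assoc] at ht
  rw [← List.take_append_drop (N (h.1⁻¹ * g.1)) w]
  exact trivialAt_append (hN _ _ _ (by rw [List.length_take, min_eq_left hle]) ht)

/-- The first `m` letters bring `g` into the nucleus. Triviality of the section there is equivalence
to the state `1`, which the next `n` letters already decide. -/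
theorem exists_trivialAt_of_ncard_reachSet [Nonempty X] (hG : IsContracting G X)
    (hA : nucleus G X ⊆ A.carrier) {n : ℕ}
    (hn : ∀ w : List X, w.length = n → (A.reachSet w).ncard = 1) (g : G) :
    ∃ m, ∀ w v : List X, w.length = m → TrivialAt g (w ++ v) → TrivialAt g w := by
  obtain ⟨N, hN, hNuc⟩ := (nucleus_isLeast hG).1
  -- All sections of `1` are `1`, so absorption places it in the nucleus.
  have hone : (1 : G) ∈ A.carrier := by
    obtain ⟨m, hm⟩ := hN 1
    have := hm (List.replicate m (Classical.arbitrary X)) List.length_replicate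
    rw [sec_one, hNuc] at this
    exact hA this
  obtain ⟨m, hm⟩ := hN g
  refine ⟨m + n, fun w v hw h => ?_⟩
  have hl : (w.take m).length = m := by rw [List.length_take]; omega
  have hsec : sec g (w.take m) ∈ A.carrier := hA (hNuc ▸ hm _ hl)
  rw [← List.take_append_drop m w, List.append_assoc, trivialAt_append_iff] at h
  rw [← List.take_append_drop m w, trivialAt_append_iff]
  refine ⟨h.1, ?_⟩
  have hrel := A.ncard_reachSet_eq_one_iff.1 (hn (w.drop m) (by rw [List.length_drop]; omega)) v
  have key : ∀ u, A.wordRel u ⟨_, hsec⟩ ⟨1, hone⟩ ↔ TrivialAt (sec g (w.take m)) u := fun u => by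
    rw [wordRel_iff, inv_one, one_mul]
  rw [← key, ← hrel, key]
  exact h.2

/-- Edges prepend letters, so paths lengthen the word on the left. -/
theorem reflTransGen_edge_append (u w : List X) :
    Relation.ReflTransGen A.Edge (A.vertex w) (A.vertex (u ++ w)) := by
  induction u with
  | nil => exact .refl
  | cons x u ih => exact ih.tail ⟨x, rfl⟩

theorem exists_append_of_reflTransGen {w : List X} {v : A.Vertex}
    (h : Relation.ReflTransGen A.Edge (A.vertex w) v) : ∃ u, v = A.vertex (u ++ w) := by
  induction h with
  | refl => exact ⟨[], rfl⟩
  | tail _ h ih =>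
    obtain ⟨u, rfl⟩ := ih
    obtain ⟨x, hx⟩ := h
    exact ⟨x :: u, Subtype.ext hx⟩

theorem exists_vertex_eq (v : A.Vertex) : ∃ w, v = A.vertex w :=
  v.2.imp fun _ h => Subtype.ext h

theorem exists_long_word_of_transGen {c : A.Vertex} (hc : Relation.TransGen A.Edge c c) (n : ℕ) :
    ∃ w, n ≤ w.length ∧ c = A.vertex w := by
  induction n with
  | zero => exact (A.exists_vertex_eq c).imp fun w h => ⟨Nat.zero_le _, h⟩
  | succ n ih =>
    obtain ⟨w, hw, hcw⟩ := ih
    -- Going once round the cycle prepends at least one letter; the last edge supplies it.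
    obtain ⟨b, hb, x, hx⟩ := Relation.TransGen.tail'_iff.1 hc
    obtain ⟨u, rfl⟩ := A.exists_append_of_reflTransGen (hcw ▸ hb)
    exact ⟨x :: (u ++ w), by simp; omega, Subtype.ext hx⟩

/-- Every vertex has an outgoing edge, and minimality supplies a path back, so the vertex lies on a
cycle. -/
theorem minimalVertices_subset_essentialVertices [Nonempty X] :
    A.minimalVertices ⊆ A.essentialVertices := by
  intro v hv
  obtain ⟨w, rfl⟩ := A.exists_vertex_eq v
  have x : X := Classical.arbitrary X
  have he : A.Edge (A.vertex w) (A.vertex (x :: w)) := ⟨x, rfl⟩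
  exact ⟨A.vertex w, .head' he (hv _ (.single he)), .refl⟩

theorem essentialVertices_subset_minimalVertices {n : ℕ}
    (hn : ∀ w : List X, w.length = n → (A.reachSet w).ncard = 1) :
    A.essentialVertices ⊆ A.minimalVertices := by
  rintro v ⟨c, hc, hcv⟩ v' hv
  obtain ⟨w, hw, rfl⟩ := A.exists_long_word_of_transGen hc n
  obtain ⟨u, rfl⟩ := A.exists_append_of_reflTransGen hcv
  have hlen : ((u ++ w).take n).length = n := by
    rw [List.length_take, List.length_append]; omega
  have hsingle := A.ncard_reachSet_eq_one_iff.1 (hn _ hlen)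
  -- The word is at least `n` long, so its relation is already that of its prefix of length `n`.
  have hvert : A.vertex (u ++ w) = A.vertex ((u ++ w).take n) := by
    refine Subtype.ext ?_
    have := hsingle ((u ++ w).drop n)
    rwa [List.take_append_drop] at this
  rw [hvert] at hv ⊢
  obtain ⟨u', rfl⟩ := A.exists_append_of_reflTransGen hv
  -- Prepending the prefix of length `n` leads back: the resulting word begins with that prefix, so
  -- its relation is the same.
  have := A.reflTransGen_edge_append ((u ++ w).take n) (u' ++ (u ++ w).take n)
  rwa [show A.vertex ((u ++ w).take n ++ (u' ++ (u ++ w).take n)) = A.vertex ((u ++ w).take n)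
    from Subtype.ext (hsingle _)] at this

end FiniteAutomaton

theorem propositionp {G X : Type*} [Group G] [Finite X] [Nontrivial X] [MulAction G (List X)]
    [SelfSimilarGroup G X] (hG : IsContracting G X) (A : FiniteAutomaton G X)
    (hA : nucleus G X ⊆ A.carrier) :
    (T2Space (TightGroupoid (SelfSimilarGroup.inverseSemigroup G X)) ↔
      ∃ n : ℕ, ∀ w : List X, w.length = n → (A.reachSet w).ncard = 1) ∧
    (T2Space (TightGroupoid (SelfSimilarGroup.inverseSemigroup G X)) →
      A.minimalVertices = A.essentialVertices) := by
  rw [SelfSimilarGroup.t2Space_iff]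
  refine ⟨⟨A.exists_ncard_reachSet_eq_one, ?_⟩, fun H => ?_⟩
  · rintro ⟨n, hn⟩
    exact A.exists_trivialAt_of_ncard_reachSet hG hA hn
  · obtain ⟨n, hn⟩ := A.exists_ncard_reachSet_eq_one H
    exact A.minimalVertices_subset_essentialVertices.antisymm
      (A.essentialVertices_subset_minimalVertices hn)
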